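/- \textbf{Setting.} Let $\mathbb{K}$ be a commutative ring and $\mathbb{K}\text{-}\mathfrak{Mod}$ the category of $\mathbb{K}$-modules. For $n\in\mathbb{N}$ let $\mathbf{B}_n$ be the braid group with Artin generators $\sigma_1,\dots,\sigma_{n-1}$ and relations $\sigma_i\sigma_{i+1}\sigma_i=\sigma_{i+1}\sigma_i\sigma_{i+1}$ and $\sigma_i\sigma_j=\sigma_j\sigma_i$ for $|i-j|\ge 2$ ($\mathbf{B}_0$, $\mathbf{B}_1$ are trivial). For $g\in\mathbf{B}_m$, $f\in\mathbf{B}_n$ let $g\natural f\in\mathbf{B}_{m+n}$ be their juxtaposition: $\sigma_i\natural id_n=\sigma_i$ and $id_m\natural\sigma_i=\sigma_{m+i}$. Let $$b_{n,m}=(\sigma_m\cdots\sigma_2\sigma_1)(\sigma_{m+1}\cdots\sigma_3\sigma_2)\cdots(\sigma_{n+m-1}\cdots\sigma_{n+1}\sigma_n)\in\mathbf{B}_{n+m}.$$ The category $\mathfrak{U}\boldsymbol{\beta}$ has the natural numbers as objects. A morphism $n\to n'$ exists only if $n\le n'$, and is then a class $[n'-n,\sigma]$ of an element $\sigma\in\mathbf{B}_{n'}$,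 where $\sigma$ and $\sigma\circ(g\natural id_n)$ are identified for all $g\in\mathbf{B}_{n'-n}$. Composition is $[n''-n',\tau]\circ[n'-n,\sigma]=[n''-n,\tau\circ(id_{n''-n'}\natural\sigma)]$. An element $\sigma\in\mathbf{B}_n$ is viewed as the automorphism $[0,\sigma]$ of $n$. The product $\natural$ is addition on objects, and on morphisms it is, for $[j,g]:m\to m'$ and $[k,f]:n\to n'$, $$[j,g]\natural[k,f]=\bigl[j+k,\ (g\natural f)\circ(id_j\natural b_{m,k}^{-1}\natural id_n)\bigr].$$ The object $0$ is initial; let $\iota_x=[x,id_x]:0\to x$. Let $\mathbf{Fct}(\mathfrak{U}\boldsymbol{\beta},\mathbb{K}\text{-}\mathfrak{Mod})$ be the category of functors $\mathfrak{U}\boldsymbol{\beta}\to\mathbb{K}\text{-}\mathfrak{Mod}$. \textbf{Translation, evanescence, difference.} For $x\in\mathbb{N}$ let $\tau_x$ be the endofunctor of $\mathbf{Fct}(\mathfrak{U}\boldsymbol{\beta},\mathbb{K}\text{-}\mathfrak{Mod})$ given by precomposition with $x\natural-$, and let $i_x:\mathrm{Id}\to\tau_x$ be the natural transformation with $i_x(F)_n=F(\iota_x\natural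 id_n)$. Put $\kappa_x=\ker(i_x)$ and $\delta_x=\operatorname{coker}(i_x)$, in the abelian category of endofunctors. \textbf{Coherent and reliable families.} Let $\mathbf{F}_n$ be the free group on $g_1,\dots,g_n$, and identify $\mathbf{F}_m*\mathbf{F}_n$ with $\mathbf{F}_{m+n}$, the generators of $\mathbf{F}_m$ coming first. Write $\iota_{\mathbf{F}_m}$ for the trivial homomorphism $0\to\mathbf{F}_m$ and $e_{\mathbf{F}_m}$ for the neutral element; thus $\iota_{\mathbf{F}_m}*id_{\mathbf{F}_n}:\mathbf{F}_n\to\mathbf{F}_{m+n}$ maps $g_i$ to $g_{m+i}$, $id_{\mathbf{F}_m}*\iota_{\mathbf{F}_n}:\mathbf{F}_m\to\mathbf{F}_{m+n}$ maps $g_i$ to $g_i$, and $e_{\mathbf{F}_m}*g=(\iota_{\mathbf{F}_m}*id_{\mathbf{F}_n})(g)$. Families of group homomorphisms $\varsigma_n:\mathbf{F}_n\to\mathbf{B}_{1+n}$ and $a_n:\mathbf{B}_n\to\mathrm{Aut}(\mathbf{F}_n)$, $n\in\mathbb{N}$, are \emph{coherent} if, for all $n\le n'$: \begin{enumerate} \item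 $(id_1\natural[n'-n,id_{n'}])\circ\varsigma_n(g)=\varsigma_{n'}(e_{\mathbf{F}_{n'-n}}*g)\circ(id_1\natural[n'-n,id_{n'}])$ in $\mathfrak{U}\boldsymbol{\beta}$, for all $g\in\mathbf{F}_n$; \item $(\iota_{\mathbf{F}_{n'-n}}*id_{\mathbf{F}_n})\circ a_n(\sigma)=a_{n'}(\sigma'\natural\sigma)\circ(\iota_{\mathbf{F}_{n'-n}}*id_{\mathbf{F}_n})$ for all $\sigma\in\mathbf{B}_n$, $\sigma'\in\mathbf{B}_{n'-n}$; \item $(id_1\natural\sigma)\circ\varsigma_n(g)=\varsigma_n(a_n(\sigma)(g))\circ(id_1\natural\sigma)$ in $\mathbf{B}_{1+n}$ for all $\sigma\in\mathbf{B}_n$, $g\in\mathbf{F}_n$. \end{enumerate} Coherent families are \emph{reliable} if moreover, for all $n\le n'$: \begin{enumerate} \item[(4)] $a_{1+n'}(b_{1,n'-n}^{-1}\natural id_n)\circ(\iota_{\mathbf{F}_{n'-n}}*id_{\mathbf{F}_{1+n}})\circ(id_{\mathbf{F}_1}*\iota_{\mathbf{F}_n})=id_{\mathbf{F}_1}*\iota_{\mathbf{F}_{n'}}$;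 \item[(5)] $a_{n'}(id_{n'-n}\natural\sigma)\circ(id_{\mathbf{F}_{n'-n}}*\iota_{\mathbf{F}_n})=id_{\mathbf{F}_{n'-n}}*\iota_{\mathbf{F}_n}$ for all $\sigma\in\mathbf{B}_n$. \end{enumerate} \textbf{The Long--Moody functor.} Let $\mathcal{I}_{\mathbb{K}[\mathbf{F}_n]}$ be the augmentation ideal of $\mathbb{K}[\mathbf{F}_n]$. For coherent families, $\mathbf{LM}=\mathbf{LM}_{a,\varsigma}$ is the endofunctor of $\mathbf{Fct}(\mathfrak{U}\boldsymbol{\beta},\mathbb{K}\text{-}\mathfrak{Mod})$ given on objects by $$\mathbf{LM}(F)(n)=\mathcal{I}_{\mathbb{K}[\mathbf{F}_n]}\otimes_{\mathbb{K}[\mathbf{F}_n]}F(1+n),$$ where $\mathbf{F}_n$ acts on $F(1+n)$ through $\varsigma_n$, with $$\mathbf{LM}(F)([n'-n,\sigma])(i\otimes v)=a_{n'}(\sigma)\bigl((\iota_{\mathbf{F}_{n'-n}}*id_{\mathbf{F}_n})(i)\bigr)\otimes F(id_1\natural[n'-n,\sigma])(v),$$ the group homomorphisms being extended linearly to augmentation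 ideals; on a natural transformation $\eta$ it is $\mathbf{LM}(\eta)_n=id\otimes\eta_{1+n}$. \textbf{Theorem} (splitting of the difference functor)\textbf{.} \label{thm:Splitting LM} Let $\{\varsigma_n\}_{n\in\mathbb{N}}$ and $\{a_n\}_{n\in\mathbb{N}}$ be coherent reliable families. Then there is a natural isomorphism of endofunctors of $\mathbf{Fct}(\mathfrak{U}\boldsymbol{\beta},\mathbb{K}\text{-}\mathfrak{Mod})$ $$\delta_1\circ\mathbf{LM}\;\cong\;\tau_2\oplus(\mathbf{LM}\circ\delta_1).$$ Moreover, there is a natural isomorphism $\kappa_1\circ\mathbf{LM}\cong\mathbf{LM}\circ\kappa_1$. -/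

import Mathlib

open CategoryTheory CategoryTheory.Limits
open scoped TensorProduct

namespace LongMoody

universe u

noncomputable section

/-! ### Braid groups -/

/-- The Artin relations. The generator `⟨i, _⟩`, with `i + 1 < n`, is the Artin generator
`σ_{i+1}` of the braid group on `n` strands (so indices are shifted by one). -/
def braidRels (n : ℕ) : Set (FreeGroup {i : ℕ // i + 1 < n}) :=
  {r | (∃ i j : {i : ℕ // i + 1 < n}, i.1 + 1 = j.1 ∧
          r = (FreeGroup.of i * FreeGroup.of j * FreeGroup.of i) *
            (FreeGroup.of j * FreeGroup.of i * FreeGroup.of j)⁻¹) ∨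
       (∃ i j : {i : ℕ // i + 1 < n}, i.1 + 2 ≤ j.1 ∧
          r = (FreeGroup.of i * FreeGroup.of j) * (FreeGroup.of j * FreeGroup.of i)⁻¹)}

/-- The braid group `B_n` (trivial for `n = 0, 1`). The product `σ * τ` is the composite
`σ ∘ τ` in the braid groupoid. -/
abbrev BraidGroup (n : ℕ) : Type := PresentedGroup (braidRels n)

namespace BraidGroup

/-- The Artin generator `σ_{i+1}` of `B_n`. -/
def gen {n : ℕ} (i : ℕ) (h : i + 1 < n) : BraidGroup n := PresentedGroup.of ⟨i, h⟩

theorem gen_braid {n : ℕ} (i : ℕ) (h : i + 1 + 1 < n) :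
    gen i (by omega) * gen (i + 1) h * gen i (by omega) =
      gen (i + 1) h * gen i (by omega) * gen (n := n) (i + 1) h := by
  rw [← mul_inv_eq_one]
  exact PresentedGroup.one_of_mem (rels := braidRels n)
    (Or.inl ⟨⟨i, by omega⟩, ⟨i + 1, h⟩, rfl, rfl⟩)

theorem gen_comm {n : ℕ} (i j : ℕ) (hi : i + 1 < n) (hj : j + 1 < n) (hij : i + 2 ≤ j) :
    gen i hi * gen j hj = gen (n := n) j hj * gen i hi := by
  rw [← mul_inv_eq_one]
  exact PresentedGroup.one_of_mem (rels := braidRels n)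
    (Or.inr ⟨⟨i, hi⟩, ⟨j, hj⟩, hij, rfl⟩)

/-- For `d + n ≤ N`, the homomorphism `B_n → B_N`, `σ_i ↦ σ_{d+i}`. It places `d` trivial
strands to the left of a braid and `N - d - n` trivial strands to its right, that is, it is
`id_d ♮ - ♮ id_{N-d-n}`. -/
def shift (d : ℕ) {n N : ℕ} (h : d + n ≤ N) : BraidGroup n →* BraidGroup N :=
  PresentedGroup.toGroup (f := fun i => gen (d + i.1) (by have := i.2; omega)) (by
    rintro r (⟨i, j, hij, rfl⟩ | ⟨i, j, hij, rfl⟩)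
    · obtain ⟨i, hi⟩ := i
      obtain ⟨j, hj⟩ := j
      obtain rfl : i + 1 = j := hij
      simp only [map_mul, map_inv, FreeGroup.lift_apply_of]
      rw [mul_inv_eq_one]
      exact gen_braid (d + i) (by omega)
    · simp only [map_mul, map_inv, FreeGroup.lift_apply_of]
      rw [mul_inv_eq_one]
      exact gen_comm _ _ _ _ (by omega))

/-- The monoidal product `g ♮ f` of two braids: `g` is laid to the left of `f`. -/
def tensor {m n : ℕ} (g : BraidGroup m) (f : BraidGroup n) : BraidGroup (m + n) :=
  shift 0 (by omega) g * shift m le_rfl f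

/-- The braid `b_{1,m} = σ_m ∘ ⋯ ∘ σ_2 ∘ σ_1`. -/
def strandBraiding (m : ℕ) : BraidGroup (1 + m) :=
  (List.ofFn fun i : Fin m => gen (m - 1 - i.1) (by omega)).prod

/-- The braiding `b_{n,m} : n ♮ m → m ♮ n`, namely the product
`(σ_m ⋯ σ_1) ∘ ⋯ ∘ (σ_{n+m-2} ⋯ σ_{n-1}) ∘ (σ_{n+m-1} ⋯ σ_n)`; the `j`-th factor is
`σ_{m+j} ⋯ σ_{1+j}` for `j = 0, …, n - 1`. -/
def braiding (n m : ℕ) : BraidGroup (n + m) :=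
  (List.ofFn fun j : Fin n => shift j.1 (by omega) (strandBraiding m)).prod

@[simp]
theorem shift_gen (d : ℕ) {n N : ℕ} (h : d + n ≤ N) (i : ℕ) (hi : i + 1 < n) :
    shift d h (gen i hi) = gen (d + i) (by omega) :=
  PresentedGroup.toGroup.of _

theorem hom_ext {n : ℕ} {G : Type*} [Group G] {φ ψ : BraidGroup n →* G}
    (h : ∀ i hi, φ (gen i hi) = ψ (gen i hi)) : φ = ψ :=
  PresentedGroup.ext fun x => h x.1 x.2

theorem shift_shift (d e : ℕ) {n N M : ℕ} (h : d + n ≤ N) (h' : e + N ≤ M) (x : BraidGroup n) :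
    shift e h' (shift d h x) = shift (e + d) (by omega) x := by
  have : (shift e h').comp (shift d h) = shift (e + d) (n := n) (N := M) (by omega) :=
    hom_ext fun i hi => by simp [add_assoc]
  exact DFunLike.congr_fun this x

theorem shift_zero {n : ℕ} (h : 0 + n ≤ n) (x : BraidGroup n) : shift 0 h x = x := by
  have : shift 0 h = MonoidHom.id (BraidGroup n) := hom_ext fun i hi => by simp
  exact DFunLike.congr_fun this x

theorem shift_congr {d d' : ℕ} {n N : ℕ} (hd : d = d') (h : d + n ≤ N) (x : BraidGroup n) :
    shift d h x = shift d' (hd ▸ h) x := by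
  subst hd; rfl

theorem induction_on {n : ℕ} {p : BraidGroup n → Prop} (x : BraidGroup n)
    (hg : ∀ i hi, p (gen i hi)) (h1 : p 1) (hm : ∀ x y, p x → p y → p (x * y))
    (hi : ∀ x, p x → p x⁻¹) : p x := by
  have hx : x ∈ Subgroup.closure (Set.range (PresentedGroup.of (rels := braidRels n))) := by
    rw [PresentedGroup.closure_range_of]; trivial
  induction hx using Subgroup.closure_induction with
  | mem y hy => obtain ⟨z, rfl⟩ := hy; exact hg z.1 z.2
  | one => exact h1
  | mul x y _ _ hx hy => exact hm x y hx hy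
  | inv x _ hx => exact hi x hx

theorem shift_commute {c d m n N : ℕ} (hc : c + m ≤ N) (hd : d + n ≤ N) (hcd : c + m ≤ d)
    (x : BraidGroup m) (y : BraidGroup n) : Commute (shift c hc x) (shift d hd y) := by
  induction x using induction_on with
  | hg i hi =>
    induction y using induction_on with
    | hg j hj =>
      rw [shift_gen, shift_gen]
      exact gen_comm _ _ _ _ (by omega)
    | h1 => rw [map_one]; exact Commute.one_right _
    | hm x y hx hy => rw [map_mul]; exact hx.mul_right hy
    | hi x hx => rw [map_inv]; exact hx.inv_right
  | h1 => rw [map_one]; exact Commute.one_left _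
  | hm x y hx hy => rw [map_mul]; exact hx.mul_left hy
  | hi x hx => rw [map_inv]; exact hx.inv_left

theorem strandBraiding_succ (m : ℕ) :
    strandBraiding (m + 1) = gen m (by omega) * shift 0 (by omega) (strandBraiding m) := by
  unfold strandBraiding
  rw [List.ofFn_succ, List.prod_cons, map_list_prod, List.map_ofFn]
  congr 1
  congr 2
  funext i
  simp only [Function.comp, shift_gen]
  congr 1
  simp only [Fin.val_succ]
  omega

theorem strandBraiding_gen (m i : ℕ) (hi : i + 1 < m) :
    strandBraiding m * gen (i + 1) (by omega) = gen i (by omega) * strandBraiding m := by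
  induction m generalizing i with
  | zero => omega
  | succ m ih =>
    rw [strandBraiding_succ]
    rcases Nat.lt_or_ge (i + 1) m with h | h
    · have := congrArg (shift (N := 1 + (m + 1)) 0 (by omega)) (ih i h)
      simp only [map_mul, shift_gen, Nat.zero_add] at this
      rw [mul_assoc, this, ← mul_assoc, ← mul_assoc, gen_comm i m _ _ (by omega)]
    · obtain rfl : m = i + 1 := by omega
      rw [strandBraiding_succ, map_mul, shift_shift, shift_gen]
      simp only [Nat.zero_add]
      have hc : Commute (shift (N := 1 + (i + 1 + 1)) 0 (by omega) (strandBraiding i))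
          (gen (i + 1) (by omega)) := by
        have := shift_commute (N := 1 + (i + 1 + 1)) (c := 0) (d := i + 1) (n := 2)
          (by omega) (by omega) (by omega) (strandBraiding i) (gen 0 (by omega))
        simpa using this
      have hb := gen_braid (n := 1 + (i + 1 + 1)) i (by omega)
      rw [mul_assoc, mul_assoc, hc.eq]
      rw [← mul_assoc, ← mul_assoc, ← hb]
      simp only [mul_assoc]

theorem strandBraiding_natural (m : ℕ) (g : BraidGroup m) :
    strandBraiding m * shift 1 le_rfl g = shift 0 (by omega) g * strandBraiding m := by
  suffices h : (MulAut.conj (strandBraiding m)).toMonoidHom.comp (shift 1 le_rfl) =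
      shift (n := m) 0 (by omega) by
    have := DFunLike.congr_fun h g
    simp only [MonoidHom.comp_apply, MulEquiv.coe_toMonoidHom, MulAut.conj_apply] at this
    rw [← this]; group
  refine hom_ext fun i hi => ?_
  simp only [MonoidHom.comp_apply, MulEquiv.coe_toMonoidHom, MulAut.conj_apply, shift_gen]
  rw [mul_inv_eq_iff_eq_mul]
  have := strandBraiding_gen m i hi
  simp only [Nat.add_comm 1 i, Nat.zero_add]
  exact this

theorem strandBraiding_add (l k : ℕ) :
    strandBraiding (l + k) =
      shift l (by omega) (strandBraiding k) * shift 0 (by omega) (strandBraiding l) := by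
  induction k with
  | zero => simp [strandBraiding, shift_zero]
  | succ k ih =>
    have e := strandBraiding_succ (l + k)
    rw [ih, map_mul, shift_shift, shift_shift] at e
    refine e.trans ?_
    rw [strandBraiding_succ k, map_mul, shift_shift, shift_gen, mul_assoc]
    simp only [Nat.zero_add, Nat.add_zero]

theorem braiding_zero (m : ℕ) : braiding 0 m = 1 := by simp [braiding]

theorem braiding_succ (x k : ℕ) :
    braiding (x + 1) k = shift 0 (by omega) (strandBraiding k) *
      shift 1 (by omega) (braiding x k) := by
  unfold braiding
  rw [List.ofFn_succ, List.prod_cons, map_list_prod, List.map_ofFn]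
  congr 3
  funext i
  simp only [Function.comp, shift_shift]
  exact shift_congr (by simp only [Fin.val_succ]; omega) _ _

/-- Naturality of the braiding in its second variable:
`b_{x,k} ∘ (id_x ♮ g) = (g ♮ id_x) ∘ b_{x,k}`. -/
theorem braiding_natural (x k : ℕ) (g : BraidGroup k) :
    braiding x k * shift x le_rfl g = shift 0 (by omega) g * braiding x k := by
  induction x with
  | zero =>
    rw [braiding_zero, one_mul, mul_one]
  | succ x ih =>
    rw [braiding_succ, mul_assoc]
    have h1 := congrArg (shift (N := x + 1 + k) 1 (by omega)) ih
    rw [map_mul, map_mul, shift_shift, shift_shift] at h1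
    have h2 := congrArg (shift (N := x + 1 + k) 0 (by omega)) (strandBraiding_natural k g)
    rw [map_mul, map_mul, shift_shift, shift_shift] at h2
    rw [shift_congr (Nat.add_comm x 1), h1, ← mul_assoc, ← mul_assoc]
    exact congrArg (· * _) h2

/-- `b_{x,l+k} = (id_l ♮ b_{x,k}) ∘ (b_{x,l} ♮ id_k)`. -/
theorem braiding_add (x l k : ℕ) :
    braiding x (l + k) =
      shift l (by omega) (braiding x k) * shift 0 (by omega) (braiding x l) := by
  induction x with
  | zero => simp only [braiding_zero, map_one, mul_one]
  | succ x ih =>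
    rw [braiding_succ, strandBraiding_add, ih, braiding_succ x k, braiding_succ x l]
    simp only [map_mul, shift_shift]
    have hc := shift_commute (N := x + 1 + (l + k)) (c := 0) (d := l + 1) (by omega) (by omega)
      (by omega) (strandBraiding l) (braiding x k)
    simp only [Nat.zero_add, Nat.add_zero, Nat.add_comm 1 l, mul_assoc]
    congr 1
    rw [← mul_assoc, ← mul_assoc, hc.eq]

end BraidGroup

/-! ### Quillen's bracket construction on the braid groupoid -/

/-- A representative `(k, f)` of a morphism `n → n'`: an object `k` of the braid groupoid
together with a morphism `f : k ♮ n → n'` of the braid groupoid, i.e. `k + n = n'` and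
`f ∈ B_{n'}`. -/
structure PreHom (n n' : ℕ) where
  compl : ℕ
  eq : compl + n = n'
  braid : BraidGroup n'

/-- `(k, f) ∼ (k, f')` iff `f = f' ∘ (g ♮ id_n)` for some `g ∈ B_k` (here `p.compl = q.compl`
is automatic, both being `n' - n`). -/
instance preHomSetoid (n n' : ℕ) : Setoid (PreHom n n') where
  r p q := ∃ g : BraidGroup p.compl,
    p.braid = q.braid * BraidGroup.shift 0 (by have := p.eq; omega) g
  iseqv := by
    refine ⟨fun p => ⟨1, by rw [map_one, mul_one]⟩, ?_, ?_⟩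
    · rintro ⟨k, h, f⟩ ⟨k', h', f'⟩ ⟨g, hg⟩
      obtain rfl : k = k' := by omega
      exact ⟨g⁻¹, by dsimp only at hg ⊢; rw [hg, map_inv, mul_inv_cancel_right]⟩
    · rintro ⟨k, h, f⟩ ⟨k', h', f'⟩ ⟨k'', h'', f''⟩ ⟨g, hg⟩ ⟨g', hg'⟩
      obtain rfl : k = k' := by omega
      obtain rfl : k = k'' := by omega
      exact ⟨g' * g, by dsimp only at hg hg' ⊢; rw [hg, hg', map_mul, mul_assoc]⟩

/-- The objects of the category `𝔘β`: the natural numbers. -/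
structure UBeta where of ::
  strands : ℕ

namespace UBeta

open BraidGroup

/-- The morphism `[k, f] : n → n'` of `𝔘β`. -/
def mkQ {n n' : ℕ} (k : ℕ) (h : k + n = n') (f : BraidGroup n') :
    Quotient (preHomSetoid n n') :=
  Quotient.mk _ ⟨k, h, f⟩

/-- Composition of representatives:
`[l, g] ∘ [k, f] = [l ♮ k, g ∘ (id_l ♮ f)]`. -/
def compQ {n n' n'' : ℕ} (p : Quotient (preHomSetoid n n')) (q : Quotient (preHomSetoid n' n'')) :
    Quotient (preHomSetoid n n'') :=
  Quotient.map₂ (fun p q => ⟨q.compl + p.compl, by have := p.eq; have := q.eq; omega,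
      q.braid * shift q.compl (by have := q.eq; omega) p.braid⟩) (by
    rintro ⟨k, h, f⟩ ⟨k', h', f'⟩ ⟨φ, hφ⟩ ⟨l, e, g⟩ ⟨l', e', g'⟩ ⟨ψ, hψ⟩
    obtain rfl : k = k' := by omega
    obtain rfl : l = l' := by omega
    change BraidGroup k at φ
    change BraidGroup l at ψ
    dsimp only at hφ hψ
    refine ⟨tensor ψ φ, ?_⟩
    dsimp only
    have hc := shift_commute (N := n'') (c := 0) (d := l) (by omega) (by omega) (by omega) ψ f'
    rw [hφ, hψ, tensor, map_mul, map_mul, shift_shift, shift_shift, shift_shift, mul_assoc,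
      mul_assoc]
    simp only [Nat.zero_add, Nat.add_zero]
    rw [← mul_assoc (shift 0 _ ψ), hc.eq, mul_assoc]) p q

instance : Category UBeta where
  Hom m n := Quotient (preHomSetoid m.strands n.strands)
  id n := mkQ 0 (Nat.zero_add _) 1
  comp p q := compQ p q
  id_comp p := by
    induction p using Quotient.inductionOn with
    | h p => exact Quotient.sound ⟨1, by simp⟩
  comp_id p := by
    induction p using Quotient.inductionOn with
    | h p =>
      refine Quotient.sound ⟨1, ?_⟩
      dsimp only
      rw [shift_zero, map_one, one_mul, mul_one]
  assoc p q r := by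
    induction p using Quotient.inductionOn with
    | h p =>
    induction q using Quotient.inductionOn with
    | h q =>
    induction r using Quotient.inductionOn with
    | h r =>
      refine Quotient.sound ⟨1, ?_⟩
      dsimp only
      rw [map_mul, shift_shift, map_one, mul_one, mul_assoc]

/-- The morphism `[k, f] : n → n'` of `𝔘β`, where `k + n = n'` and `f ∈ B_{n'}`. -/
def homMk {n n' : UBeta} (k : ℕ) (h : k + n.strands = n'.strands) (f : BraidGroup n'.strands) :
    n ⟶ n' :=
  mkQ k h f

theorem hom_ind {n n' : UBeta} {P : (n ⟶ n') → Prop} (h : ∀ k e f, P (homMk k e f))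
    (p : n ⟶ n') : P p :=
  Quotient.inductionOn p fun p => h p.compl p.eq p.braid

theorem homMk_eq_homMk {n n' : UBeta} {k k' : ℕ} {h : k + n.strands = n'.strands}
    {h' : k' + n.strands = n'.strands} {f f' : BraidGroup n'.strands} (g : BraidGroup k)
    (hg : f = f' * shift 0 (by omega) g) : (homMk k h f : n ⟶ n') = homMk k' h' f' :=
  Quotient.sound ⟨g, hg⟩

theorem homMk_congr {n n' : UBeta} {k k' : ℕ} {h : k + n.strands = n'.strands}
    {h' : k' + n.strands = n'.strands} {f f' : BraidGroup n'.strands}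
    (hf : f = f') : (homMk k h f : n ⟶ n') = homMk k' h' f' :=
  homMk_eq_homMk 1 (by rw [hf, map_one, mul_one])

theorem id_eq (n : UBeta) : 𝟙 n = homMk 0 (Nat.zero_add _) 1 := rfl

theorem homMk_comp_homMk {n n' n'' : UBeta} {k l : ℕ} (h : k + n.strands = n'.strands)
    (e : l + n'.strands = n''.strands) (f : BraidGroup n'.strands) (g : BraidGroup n''.strands) :
    (homMk k h f : n ⟶ n') ≫ (homMk l e g : n' ⟶ n'') =
      homMk (l + k) (by omega) (g * shift l (by omega) f) := rfl

/-- The canonical functor `β → 𝔘β` on automorphisms: `σ ↦ [0, σ]`. -/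
def aut (n : UBeta) : BraidGroup n.strands →* End n where
  toFun σ := homMk 0 (Nat.zero_add _) σ
  map_one' := rfl
  map_mul' σ τ := by
    rw [End.mul_def, homMk_comp_homMk]
    exact homMk_congr (by rw [shift_zero])

theorem mul_inv_eq_inv_mul {G : Type*} [Group G] {b x y : G} (h : b * x = y * b) :
    x * b⁻¹ = b⁻¹ * y := by
  rw [eq_inv_mul_iff_mul_eq, ← mul_assoc, h, mul_inv_cancel_right]

/-- The monoidal product on objects. -/
abbrev tensorObj (m n : UBeta) : UBeta := ⟨m.strands + n.strands⟩

/-- The monoidal product on morphisms: for `[j, g] : m → m'` and `[k, f] : n → n'`,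
`[j, g] ♮ [k, f] = [j ♮ k, (g ♮ f) ∘ (id_j ♮ b_{m,k}⁻¹ ♮ id_n)] : m ♮ n → m' ♮ n'`. -/
def tensorHom {m m' n n' : UBeta} (p : m ⟶ m') (q : n ⟶ n') :
    tensorObj m n ⟶ tensorObj m' n' :=
  Quotient.map₂ (fun p q => (⟨p.compl + q.compl,
      by have := p.eq; have := q.eq; omega,
      tensor p.braid q.braid * shift p.compl (by have := p.eq; have := q.eq; omega)
        (braiding m.strands q.compl)⁻¹⟩ :
        PreHom (m.strands + n.strands) (m'.strands + n'.strands))) (by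
    rintro ⟨j, h, g⟩ ⟨j', h', g'⟩ ⟨φ, hφ⟩ ⟨k, e, f⟩ ⟨k', e', f'⟩ ⟨ψ, hψ⟩
    obtain rfl : j = j' := by omega
    obtain rfl : k = k' := by omega
    change BraidGroup j at φ
    change BraidGroup k at ψ
    dsimp only at hφ hψ
    refine ⟨tensor φ ψ, ?_⟩
    dsimp only
    have h1 := shift_commute (N := m'.strands + n'.strands) (c := 0) (d := m'.strands)
      (by omega) (by omega) (by omega) φ f'
    have h2 := shift_commute (N := m'.strands + n'.strands) (c := 0) (d := j)
      (by omega) (by omega) (by omega) φ (braiding m.strands k)⁻¹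
    have h3 := congrArg (shift (N := m'.strands + n'.strands) j (by omega))
      (braiding_natural m.strands k ψ)
    rw [map_mul, map_mul, shift_shift, shift_shift, shift_congr h] at h3
    replace h3 := mul_inv_eq_inv_mul h3
    rw [hφ, hψ]
    simp only [tensor, map_mul, map_inv, shift_shift, Nat.zero_add, Nat.add_zero] at h2 h3 ⊢
    simp only [mul_assoc]
    rw [← mul_assoc (shift 0 _ φ) (shift _ _ f'), h1.eq, mul_assoc, h3,
      ← mul_assoc (shift 0 _ φ), h2.eq, mul_assoc]) p q

theorem tensorHom_homMk {m m' n n' : UBeta} {j k : ℕ} (h : j + m.strands = m'.strands)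
    (e : k + n.strands = n'.strands) (g : BraidGroup m'.strands) (f : BraidGroup n'.strands) :
    tensorHom (homMk j h g : m ⟶ m') (homMk k e f : n ⟶ n') =
      homMk (j + k) (by change _ + (_ + _) = _ + _; omega)
        (tensor g f * shift j (by omega) (braiding m.strands k)⁻¹) := rfl

theorem id_tensorHom_homMk (x : UBeta) {n n' : UBeta} {k : ℕ}
    (e : k + n.strands = n'.strands) (f : BraidGroup n'.strands) :
    tensorHom (𝟙 x) (homMk k e f : n ⟶ n') =
      homMk k (by change _ + (_ + _) = _ + _; omega)
        (shift (N := x.strands + n'.strands) x.strands le_rfl f *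
          shift 0 (by omega) (braiding x.strands k)⁻¹) := by
  rw [id_eq, tensorHom_homMk]
  refine homMk_congr ?_
  rw [tensor, map_one, one_mul]

/-- The endofunctor `x ♮ -` of `𝔘β`. -/
@[simps]
def tensorLeft (x : UBeta) : UBeta ⥤ UBeta where
  obj n := tensorObj x n
  map f := tensorHom (𝟙 x) f
  map_id n := by
    rw [id_eq n, id_tensorHom_homMk]
    refine homMk_congr ?_
    have : braiding x.strands 0 = 1 := by
      have := braiding_add x.strands 0 0
      rw [shift_zero] at this
      exact (mul_eq_left.mp this.symm)
    rw [this, inv_one, map_one, map_one]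
    exact one_mul _
  map_comp {a b c} f g := by
    induction f using hom_ind with
    | h k e f =>
    induction g using hom_ind with
    | h l e' g =>
      rw [homMk_comp_homMk, id_tensorHom_homMk, id_tensorHom_homMk, id_tensorHom_homMk, homMk_comp_homMk]
      refine homMk_congr ?_
      have hc := shift_commute (N := x.strands + c.strands) (c := 0) (d := l + x.strands)
        (by omega) (by omega) (by omega) (braiding x.strands l)⁻¹ f
      rw [braiding_add]
      simp only [mul_inv_rev, map_mul, map_inv, shift_shift, Nat.zero_add, Nat.add_zero] at hc ⊢
      rw [shift_congr (Nat.add_comm x.strands l)]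
      simp only [mul_assoc]
      congr 1
      simp only [← mul_assoc]
      rw [hc.eq]

/-- The morphism `ι_x = [x, id_x] : 0 → x`. -/
def ι (x : UBeta) : (⟨0⟩ : UBeta) ⟶ x := homMk x.strands (Nat.add_zero _) 1

/-- The object `0` is initial in `𝔘β`. -/
theorem eq_ι {x : UBeta} (f : (⟨0⟩ : UBeta) ⟶ x) : f = ι x := by
  induction f using hom_ind with
  | h k e f =>
    obtain ⟨x⟩ := x
    obtain rfl : k = x := e
    exact homMk_eq_homMk f (by rw [one_mul, shift_zero])

/-- The (strict) left unit identification `n = 0 ♮ n`. -/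
def leftUnit (n : UBeta) : n ⟶ tensorObj ⟨0⟩ n := eqToHom (by simp [tensorObj])

theorem leftUnit_eq (n : UBeta) :
    leftUnit n = homMk 0 rfl 1 := by
  have : ∀ (m : UBeta) (h : n = m), eqToHom h = homMk 0 (by rw [h, Nat.zero_add]) 1 := by
    rintro m rfl; rfl
  exact this _ _

theorem leftUnit_comp (x n : UBeta) :
    leftUnit n ≫ tensorHom (ι x) (𝟙 n) = homMk x.strands rfl 1 := by
  rw [leftUnit_eq, ι, id_eq, tensorHom_homMk, homMk_comp_homMk]
  refine homMk_congr ?_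
  rw [braiding_zero]
  simp [tensor]

/-- The natural transformation `ι_x ♮ id_n : n = 0 ♮ n → x ♮ n`. -/
@[simps]
def unitTensor (x : UBeta) : 𝟭 UBeta ⟶ tensorLeft x where
  app n := leftUnit n ≫ tensorHom (ι x) (𝟙 n)
  naturality a b f := by
    induction f using hom_ind with
    | h k e f =>
      change homMk k e f ≫ (leftUnit b ≫ tensorHom (ι x) (𝟙 b)) =
        (leftUnit a ≫ tensorHom (ι x) (𝟙 a)) ≫ tensorHom (𝟙 x) (homMk k e f)
      rw [leftUnit_comp, leftUnit_comp, id_tensorHom_homMk]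
      refine (homMk_comp_homMk ..).trans (Eq.trans ?_ (homMk_comp_homMk ..).symm)
      refine homMk_eq_homMk (braiding x.strands k) ?_
      simp [tensorObj]

end UBeta

/-! ### Families of morphisms between braid groups and free groups -/

/-- For `d + n ≤ N`, the homomorphism `F_n → F_N`, `g_i ↦ g_{d+i}`, i.e.
`ι_{F_d} * id_{F_n} * ι_{F_{N-d-n}}`. -/
def freeShift (d : ℕ) {n N : ℕ} (h : d + n ≤ N) : FreeGroup (Fin n) →* FreeGroup (Fin N) :=
  FreeGroup.map fun i => ⟨d + i.1, by omega⟩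

theorem freeShift_freeShift (d e : ℕ) {n N M : ℕ} (h : d + n ≤ N) (h' : e + N ≤ M)
    (x : FreeGroup (Fin n)) :
    freeShift e h' (freeShift d h x) = freeShift (e + d) (by omega) x := by
  simp only [freeShift, FreeGroup.map.comp]
  congr 2
  funext i
  simp [add_assoc]

theorem freeShift_zero {n : ℕ} (h : 0 + n ≤ n) (x : FreeGroup (Fin n)) :
    freeShift 0 h x = x := by
  simp only [freeShift, Nat.zero_add]
  exact FreeGroup.map.id x

open BraidGroup UBeta

/-- Coherence of families `ς_n : F_n → B_{1+n}` and `a_n : B_n → Aut(F_n)`. -/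
structure Coherent (ς : ∀ n : ℕ, FreeGroup (Fin n) →* BraidGroup (1 + n))
    (a : ∀ n : ℕ, BraidGroup n →* MulAut (FreeGroup (Fin n))) : Prop where
  /-- `(id_1 ♮ [n'-n, id_{n'}]) ∘ ς_n(g) = ς_{n'}(e_{F_{n'-n}} * g) ∘ (id_1 ♮ [n'-n, id_{n'}])`
  in `𝔘β`, where `n' - n = k`. -/
  stability : ∀ (k n n' : ℕ) (h : k + n = n') (g : FreeGroup (Fin n)),
    aut (tensorObj (UBeta.of 1) (UBeta.of n)) (ς n g) ≫
        tensorHom (𝟙 (UBeta.of 1)) (homMk k h 1 : UBeta.of n ⟶ UBeta.of n') =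
      tensorHom (𝟙 (UBeta.of 1)) (homMk k h 1 : UBeta.of n ⟶ UBeta.of n') ≫
        aut (tensorObj (UBeta.of 1) (UBeta.of n')) (ς n' (freeShift k h.le g))
  /-- `(ι_{F_{n'-n}} * id_{F_n}) ∘ a_n(σ) = a_{n'}(σ' ♮ σ) ∘ (ι_{F_{n'-n}} * id_{F_n})`,
  where `n' - n = k`. -/
  action_shift : ∀ (k n : ℕ) (σ' : BraidGroup k) (σ : BraidGroup n) (g : FreeGroup (Fin n)),
    freeShift k le_rfl (a n σ g) = a (k + n) (tensor σ' σ) (freeShift k le_rfl g)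
  /-- `(id_1 ♮ σ) ∘ ς_n(g) = ς_n(a_n(σ)(g)) ∘ (id_1 ♮ σ)` in `B_{1+n}`. -/
  semidirect : ∀ (n : ℕ) (σ : BraidGroup n) (g : FreeGroup (Fin n)),
    tensor (1 : BraidGroup 1) σ * ς n g = ς n (a n σ g) * tensor (1 : BraidGroup 1) σ

/-- Reliability of coherent families. -/
structure Reliable (ς : ∀ n : ℕ, FreeGroup (Fin n) →* BraidGroup (1 + n))
    (a : ∀ n : ℕ, BraidGroup n →* MulAut (FreeGroup (Fin n))) : Prop extends Coherent ς a where
  /-- `a_{1+n'}((b_{1,n'-n})⁻¹ ♮ id_n) ∘ (ι_{F_{n'-n}} * id_{F_{1+n}}) ∘ (id_{F_1} * ι_{F_n})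
  = id_{F_1} * ι_{F_{n'}}`, where `n' - n = k`. -/
  action_braiding : ∀ (k n n' : ℕ) (h : k + n = n') (g : FreeGroup (Fin 1)),
    a (1 + n') (shift 0 (by omega) (braiding 1 k)⁻¹)
        (freeShift k (by omega) (freeShift 0 (by omega : 0 + 1 ≤ 1 + n) g)) =
      freeShift 0 (by omega) g
  /-- `a_{n'}(id_{n'-n} ♮ σ) ∘ (id_{F_{n'-n}} * ι_{F_n}) = id_{F_{n'-n}} * ι_{F_n}`,
  where `n' - n = k`. -/
  action_stabilizer : ∀ (k n : ℕ) (σ : BraidGroup n) (g : FreeGroup (Fin k)),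
    a (k + n) (tensor (1 : BraidGroup k) σ) (freeShift 0 (by omega) g) = freeShift 0 (by omega) g

section Families

variable {ς : ∀ n : ℕ, FreeGroup (Fin n) →* BraidGroup (1 + n)}
  {a : ∀ n : ℕ, BraidGroup n →* MulAut (FreeGroup (Fin n))}

theorem Coherent.action_shift_left (hc : Coherent ς a) {k n n' : ℕ} (h : k + n = n')
    (ψ : BraidGroup k) (g : FreeGroup (Fin n)) :
    a n' (shift 0 (by omega) ψ) (freeShift k h.le g) = freeShift k h.le g := by
  subst h
  have := hc.action_shift k n ψ 1 g
  rw [tensor, map_one, map_one, mul_one] at this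
  exact this.symm

theorem Coherent.action_shift_right (hc : Coherent ς a) {k n n' : ℕ} (h : k + n = n')
    (σ : BraidGroup n) (g : FreeGroup (Fin n)) :
    a n' (shift k h.le σ) (freeShift k h.le g) = freeShift k h.le (a n σ g) := by
  subst h
  have := hc.action_shift k n 1 σ g
  rw [tensor, map_one, one_mul] at this
  exact this.symm

/-- The homomorphism `a_{n'}(σ) ∘ (ι_{F_{n'-n}} * id_{F_n}) : F_n → F_{n'}` attached to a
morphism `[n'-n, σ] : n → n'` of `𝔘β`. -/
def Coherent.freeHom (hc : Coherent ς a) {n n' : UBeta} (p : n ⟶ n') :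
    FreeGroup (Fin n.strands) →* FreeGroup (Fin n'.strands) :=
  Quotient.lift (fun p : PreHom n.strands n'.strands =>
    (a n'.strands p.braid).toMonoidHom.comp (freeShift p.compl p.eq.le)) (by
      rintro ⟨k, h, f⟩ ⟨k', h', f'⟩ ⟨g, hg⟩
      obtain rfl : k = k' := by omega
      change BraidGroup k at g
      dsimp only at hg ⊢
      ext1 x
      simp only [MonoidHom.comp_apply, MulEquiv.coe_toMonoidHom, hg, map_mul,
        MulAut.mul_apply]
      rw [hc.action_shift_left h]) p

theorem Coherent.freeHom_homMk (hc : Coherent ς a) {n n' : UBeta} (k : ℕ)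
    (h : k + n.strands = n'.strands) (f : BraidGroup n'.strands)
    (g : FreeGroup (Fin n.strands)) :
    hc.freeHom (homMk k h f : n ⟶ n') g = a n'.strands f (freeShift k h.le g) := rfl

theorem Coherent.freeHom_id (hc : Coherent ς a) (n : UBeta) :
    hc.freeHom (𝟙 n) = MonoidHom.id _ := by
  ext1 x
  change a n.strands 1 (freeShift 0 _ _) = _
  rw [map_one, MulAut.one_apply]
  exact freeShift_zero _ _

theorem Coherent.freeHom_comp (hc : Coherent ς a) {n n' n'' : UBeta} (p : n ⟶ n')
    (q : n' ⟶ n'') : hc.freeHom (p ≫ q) = (hc.freeHom q).comp (hc.freeHom p) := by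
  induction p using hom_ind with
  | h k e f =>
  induction q using hom_ind with
  | h l e' g =>
    refine MonoidHom.ext fun x => ?_
    rw [homMk_comp_homMk, MonoidHom.comp_apply, hc.freeHom_homMk, hc.freeHom_homMk,
      hc.freeHom_homMk, map_mul, MulAut.mul_apply, ← hc.action_shift_right e',
      freeShift_freeShift]

theorem Coherent.aut_comp (hc : Coherent ς a) {n n' : UBeta} (p : n ⟶ n')
    (g : FreeGroup (Fin n.strands)) :
    aut (tensorObj (UBeta.of 1) n) (ς n.strands g) ≫ tensorHom (𝟙 (UBeta.of 1)) p =
      tensorHom (𝟙 (UBeta.of 1)) p ≫ aut (tensorObj (UBeta.of 1) n') (ς n'.strands (hc.freeHom p g)) := by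
  induction p using hom_ind with
  | h k e f =>
    have hf : (homMk k e f : n ⟶ n') = homMk k e 1 ≫ aut n' f := by
      refine Eq.trans ?_ (homMk_comp_homMk ..).symm
      exact homMk_congr (by simp) |>.trans rfl
    have hσ : tensorHom (𝟙 (UBeta.of 1)) (aut n' f) =
        aut (tensorObj (UBeta.of 1) n') (tensor (1 : BraidGroup 1) f) := by
      refine (id_tensorHom_homMk _ _ _).trans (homMk_congr ?_)
      rw [show braiding (UBeta.of 1).strands 0 = 1 by simp [braiding, strandBraiding], tensor]
      simp
    have hstab := hc.stability k n.strands n'.strands e g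
    have hsd := congrArg (aut (tensorObj (UBeta.of 1) n'))
      (hc.semidirect n'.strands f (freeShift k e.le g))
    have hT := (tensorLeft (UBeta.of 1)).map_comp (homMk k e 1 : n ⟶ n') (aut n' f)
    simp only [tensorLeft_map] at hT
    rw [hc.freeHom_homMk, hf]
    erw [hT]
    rw [hσ]
    rw [map_mul, map_mul, End.mul_def, End.mul_def] at hsd
    erw [← Category.assoc, hstab, Category.assoc, Category.assoc, hsd]
    rfl

end Families

/-! ### The Long–Moody functor -/

section Algebra

variable (K : Type u) [CommRing K]

/-- The augmentation ideal of `K[G]` as a `K`-submodule: the kernel of `K[G] → K`, `g ↦ 1`. -/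
def augSubmodule (G : Type*) [Group G] : Submodule K (MonoidAlgebra K G) :=
  LinearMap.ker (MonoidAlgebra.lift K K G 1).toLinearMap

/-- The augmentation ideal `I_{K[G]}` as a `K`-module. -/
def AugIdeal (G : Type*) [Group G] : Type _ := augSubmodule K G

instance (G : Type*) [Group G] : AddCommGroup (AugIdeal K G) :=
  inferInstanceAs (AddCommGroup (augSubmodule K G))

instance (G : Type*) [Group G] : Module K (AugIdeal K G) :=
  inferInstanceAs (Module K (augSubmodule K G))

variable {K} {G H L : Type*} [Group G] [Group H] [Group L]

/-- The inclusion `I_{K[G]} → K[G]`. -/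
def AugIdeal.incl : AugIdeal K G →ₗ[K] MonoidAlgebra K G := (augSubmodule K G).subtype

theorem AugIdeal.ext {i j : AugIdeal K G} (h : i.incl = j.incl) : i = j := Subtype.ext h

theorem AugIdeal.incl_mem (i : AugIdeal K G) : i.incl ∈ augSubmodule K G := i.2

theorem mul_mem_augSubmodule {i : MonoidAlgebra K G} (hi : i ∈ augSubmodule K G)
    (x : MonoidAlgebra K G) : i * x ∈ augSubmodule K G := by
  simp only [augSubmodule, LinearMap.mem_ker, AlgHom.toLinearMap_apply, map_mul] at hi ⊢
  rw [hi, zero_mul]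

/-- The right action of `K[G]` on its augmentation ideal by multiplication: `i ↦ i * x`. -/
def AugIdeal.mulRight (i : AugIdeal K G) (x : MonoidAlgebra K G) : AugIdeal K G :=
  ⟨i.incl * x, mul_mem_augSubmodule i.incl_mem x⟩

/-- The map `I_{K[G]} → I_{K[H]}` induced by a group homomorphism `G → H`. -/
def augMap (φ : G →* H) : AugIdeal K G →ₗ[K] AugIdeal K H :=
  LinearMap.codRestrict (augSubmodule K H)
    ((MonoidAlgebra.mapDomainAlgHom K K φ).toLinearMap ∘ₗ AugIdeal.incl) (by
    intro i
    have hφ : (MonoidAlgebra.lift K K H 1).comp (MonoidAlgebra.mapDomainAlgHom K K φ) =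
        MonoidAlgebra.lift K K G 1 := by
      ext g; simp
    have := DFunLike.congr_fun hφ i.incl
    have hi := i.incl_mem
    simp only [augSubmodule, LinearMap.mem_ker, AlgHom.toLinearMap_apply] at hi ⊢
    rw [hi] at this
    exact this)

theorem augMap_incl (φ : G →* H) (i : AugIdeal K G) :
    (augMap φ i).incl = MonoidAlgebra.mapDomainAlgHom K K φ i.incl := rfl

variable {V W X : Type u} [AddCommGroup V] [Module K V] [AddCommGroup W] [Module K W]
  [AddCommGroup X] [Module K X]

/-- The submodule of `I_{K[G]} ⊗_K V` spanned by the elements `(i * x) ⊗ v - i ⊗ (x • v)`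
with `x ∈ K[G]` acting on `V` through the linear representation `ρ` of `G`. -/
def balancedRel (ρ : G →* Module.End K V) : Submodule K (AugIdeal K G ⊗[K] V) :=
  Submodule.span K {t | ∃ (i : AugIdeal K G) (x : MonoidAlgebra K G) (v : V),
    t = i.mulRight x ⊗ₜ[K] v -
      i ⊗ₜ[K] (MonoidAlgebra.lift K (Module.End K V) G ρ x v)}

/-- The tensor product `I_{K[G]} ⊗_{K[G]} V` of the right `K[G]`-module `I_{K[G]}` and the
left `K[G]`-module `V` given by the representation `ρ` of `G`, as a `K`-module. -/
abbrev AugTensor (ρ : G →* Module.End K V) := (AugIdeal K G ⊗[K] V) ⧸ balancedRel ρ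

/-- The pure tensor `i ⊗ v` of `I_{K[G]} ⊗_{K[G]} V`. -/
def AugTensor.tmul (ρ : G →* Module.End K V) (i : AugIdeal K G) (v : V) : AugTensor ρ :=
  (balancedRel ρ).mkQ (i ⊗ₜ[K] v)

theorem AugTensor.hom_ext {ρ : G →* Module.End K V} {Y : Type*} [AddCommGroup Y] [Module K Y]
    {f g : AugTensor ρ →ₗ[K] Y}
    (h : ∀ i v, f (tmul ρ i v) = g (tmul ρ i v)) : f = g :=
  Submodule.linearMap_qext _ (TensorProduct.ext' h)

theorem lift_intertwine {ρ : G →* Module.End K V} {ρ' : H →* Module.End K W} (φ : G →* H)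
    (T : V →ₗ[K] W) (hT : ∀ g v, T (ρ g v) = ρ' (φ g) (T v)) (x : MonoidAlgebra K G) (v : V) :
    T (MonoidAlgebra.lift K (Module.End K V) G ρ x v) =
      MonoidAlgebra.lift K (Module.End K W) H ρ' (MonoidAlgebra.mapDomainAlgHom K K φ x)
        (T v) := by
  induction x using MonoidAlgebra.induction_linear with
  | zero => simp
  | add x y hx hy => simp only [map_add, LinearMap.add_apply, hx, hy]
  | single g r => simp [hT]

/-- The map `I_{K[G]} ⊗_{K[G]} V → I_{K[H]} ⊗_{K[H]} W`, `i ⊗ v ↦ φ(i) ⊗ T(v)`, for a group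
homomorphism `φ` and a `φ`-equivariant `K`-linear map `T`. -/
def AugTensor.map {ρ : G →* Module.End K V} {ρ' : H →* Module.End K W} (φ : G →* H)
    (T : V →ₗ[K] W) (hT : ∀ g v, T (ρ g v) = ρ' (φ g) (T v)) :
    AugTensor ρ →ₗ[K] AugTensor ρ' :=
  Submodule.mapQ _ _ (TensorProduct.map (augMap φ) T) (by
    rw [balancedRel, Submodule.span_le]
    rintro _ ⟨i, x, v, rfl⟩
    refine Submodule.subset_span ⟨augMap φ i, MonoidAlgebra.mapDomainAlgHom K K φ x, T v, ?_⟩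
    rw [map_sub, TensorProduct.map_tmul, TensorProduct.map_tmul, lift_intertwine φ T hT]
    congr 2
    exact AugIdeal.ext (map_mul (MonoidAlgebra.mapDomainAlgHom K K φ) i.incl x))

@[simp]
theorem AugTensor.map_tmul {ρ : G →* Module.End K V} {ρ' : H →* Module.End K W} (φ : G →* H)
    (T : V →ₗ[K] W) (hT : ∀ g v, T (ρ g v) = ρ' (φ g) (T v)) (i : AugIdeal K G) (v : V) :
    AugTensor.map φ T hT (tmul ρ i v) = tmul ρ' (augMap φ i) (T v) := rfl

theorem augMap_id (i : AugIdeal K G) : augMap (MonoidHom.id G) i = i :=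
  AugIdeal.ext (by rw [augMap_incl, MonoidAlgebra.mapDomainAlgHom_id]; rfl)

theorem augMap_comp (φ : G →* H) (ψ : H →* L) (i : AugIdeal K G) :
    augMap (ψ.comp φ) i = augMap ψ (augMap φ i) :=
  AugIdeal.ext (by
    rw [augMap_incl, augMap_incl, augMap_incl, MonoidAlgebra.mapDomainAlgHom_comp]; rfl)

theorem AugTensor.map_eq_id {ρ : G →* Module.End K V} {φ : G →* G} {T : V →ₗ[K] V}
    (hT : ∀ g v, T (ρ g v) = ρ (φ g) (T v)) (hφ : φ = MonoidHom.id G)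
    (h : T = LinearMap.id) : AugTensor.map φ T hT = LinearMap.id := by
  subst hφ h
  refine AugTensor.hom_ext fun i v => ?_
  rw [AugTensor.map_tmul, augMap_id]
  rfl

theorem AugTensor.map_eq_comp {ρ : G →* Module.End K V} {ρ' : H →* Module.End K W}
    {ρ'' : L →* Module.End K X} {φ : G →* H} {ψ : H →* L} {χ : G →* L}
    {T : V →ₗ[K] W} {U : W →ₗ[K] X} {S : V →ₗ[K] X}
    (hT : ∀ g v, T (ρ g v) = ρ' (φ g) (T v)) (hU : ∀ g v, U (ρ' g v) = ρ'' (ψ g) (U v))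
    (hS : ∀ g v, S (ρ g v) = ρ'' (χ g) (S v)) (hχ : χ = ψ.comp φ) (h : S = U ∘ₗ T) :
    AugTensor.map χ S hS = AugTensor.map ψ U hU ∘ₗ AugTensor.map φ T hT := by
  subst hχ h
  refine AugTensor.hom_ext fun i v => ?_
  rw [LinearMap.comp_apply, AugTensor.map_tmul, AugTensor.map_tmul, AugTensor.map_tmul,
    augMap_comp]
  rfl

end Algebra

section LongMoodyFunctor

variable (K : Type u) [CommRing K]
  {ς : ∀ n : ℕ, FreeGroup (Fin n) →* BraidGroup (1 + n)}
  {a : ∀ n : ℕ, BraidGroup n →* MulAut (FreeGroup (Fin n))}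

/-- The action of `F_n` on the `K`-module `F(1 ♮ n)` by restriction along
`ς_n : F_n → B_{1+n}`. -/
def freeAction {K : Type u} [CommRing K]
    (ς : ∀ n : ℕ, FreeGroup (Fin n) →* BraidGroup (1 + n)) (F : UBeta ⥤ ModuleCat.{u} K)
    (n : UBeta) :
    FreeGroup (Fin n.strands) →* Module.End K (F.obj (tensorObj (UBeta.of 1) n)) where
  toFun g := (F.map (aut (tensorObj (UBeta.of 1) n) (ς n.strands g))).hom
  map_one' := by
    rw [map_one, map_one]
    exact congrArg ModuleCat.Hom.hom (F.map_id _)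
  map_mul' x y := by
    rw [map_mul, map_mul, End.mul_def, F.map_comp]
    rfl

theorem freeAction_tensorHom {K : Type u} [CommRing K] (hc : Coherent ς a)
    (F : UBeta ⥤ ModuleCat.{u} K) {n n' : UBeta} (p : n ⟶ n') (g : FreeGroup (Fin n.strands))
    (v : F.obj (tensorObj (UBeta.of 1) n)) :
    (F.map (tensorHom (𝟙 (UBeta.of 1)) p)).hom (freeAction ς F n g v) =
      freeAction ς F n' (hc.freeHom p g) ((F.map (tensorHom (𝟙 (UBeta.of 1)) p)).hom v) := by
  have := congrArg F.map (hc.aut_comp p g)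
  rw [F.map_comp, F.map_comp] at this
  exact congrArg (fun f => f.hom v) this

theorem freeAction_natTrans {K : Type u} [CommRing K]
    (ς : ∀ n : ℕ, FreeGroup (Fin n) →* BraidGroup (1 + n)) {F G : UBeta ⥤ ModuleCat.{u} K}
    (η : F ⟶ G) (n : UBeta) (g : FreeGroup (Fin n.strands))
    (v : F.obj (tensorObj (UBeta.of 1) n)) :
    (η.app (tensorObj (UBeta.of 1) n)).hom (freeAction ς F n g v) =
      freeAction ς G n (MonoidHom.id _ g) ((η.app (tensorObj (UBeta.of 1) n)).hom v) :=
  congrArg (fun f => f.hom v)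
    (η.naturality (aut (tensorObj (UBeta.of 1) n) (ς n.strands g)))

/-- The functor `LM(F) : 𝔘β → K-Mod`:
`LM(F)(n) = I_{K[F_n]} ⊗_{K[F_n]} F(1 ♮ n)` and
`LM(F)([n'-n, σ])(i ⊗ v) = a_{n'}(σ)((ι * id)(i)) ⊗ F(id_1 ♮ [n'-n, σ])(v)`. -/
def longMoodyObj {K : Type u} [CommRing K] (hc : Coherent ς a) (F : UBeta ⥤ ModuleCat.{u} K) :
    UBeta ⥤ ModuleCat.{u} K where
  obj n := ModuleCat.of K (AugTensor (freeAction ς F n))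
  map {n n'} p := ModuleCat.ofHom (AugTensor.map (hc.freeHom p)
    (F.map (tensorHom (𝟙 (UBeta.of 1)) p)).hom (freeAction_tensorHom hc F p))
  map_id n := by
    refine congrArg ModuleCat.ofHom
      (AugTensor.map_eq_id (freeAction_tensorHom hc F (𝟙 n)) (hc.freeHom_id n) ?_)
    have h1 : tensorHom (𝟙 (UBeta.of 1)) (𝟙 n) = 𝟙 (tensorObj (UBeta.of 1) n) :=
      (tensorLeft (UBeta.of 1)).map_id n
    rw [h1, F.map_id]
    rfl
  map_comp {n n' n''} p q := by
    refine congrArg ModuleCat.ofHom (AugTensor.map_eq_comp (freeAction_tensorHom hc F p)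
      (freeAction_tensorHom hc F q) (freeAction_tensorHom hc F (p ≫ q)) (hc.freeHom_comp p q) ?_)
    have h1 : tensorHom (𝟙 (UBeta.of 1)) (p ≫ q) =
        tensorHom (𝟙 (UBeta.of 1)) p ≫ tensorHom (𝟙 (UBeta.of 1)) q :=
      (tensorLeft (UBeta.of 1)).map_comp p q
    rw [h1, F.map_comp]
    rfl

/-- The Long–Moody functor `LM_{a,ς}`, an endofunctor of `Fct(𝔘β, K-Mod)`, with
`LM(η)_n = id ⊗ η_{1+n}` on morphisms. -/
def longMoody (hc : Coherent ς a) : (UBeta ⥤ ModuleCat.{u} K) ⥤ (UBeta ⥤ ModuleCat.{u} K) where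
  obj F := longMoodyObj hc F
  map {F G} η :=
    { app := fun n => ModuleCat.ofHom (AugTensor.map (MonoidHom.id _)
        (η.app (tensorObj (UBeta.of 1) n)).hom (freeAction_natTrans ς η n))
      naturality := by
        intro n n' p
        have h1 := congrArg ModuleCat.Hom.hom (η.naturality (tensorHom (𝟙 (UBeta.of 1)) p))
        have hS : ∀ g v, (F.map (tensorHom (𝟙 (UBeta.of 1)) p) ≫ η.app _).hom
            (freeAction ς F n g v) = freeAction ς G n' (hc.freeHom p g)
              ((F.map (tensorHom (𝟙 (UBeta.of 1)) p) ≫ η.app _).hom v) := by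
          intro g v
          rw [ModuleCat.hom_comp, LinearMap.comp_apply, LinearMap.comp_apply,
            freeAction_tensorHom hc, freeAction_natTrans]
          rfl
        exact congrArg ModuleCat.ofHom
          ((AugTensor.map_eq_comp (freeAction_tensorHom hc F p) (freeAction_natTrans ς η n') hS
            (MonoidHom.id_comp _).symm rfl).symm.trans
          (AugTensor.map_eq_comp (freeAction_natTrans ς η n) (freeAction_tensorHom hc G p) hS
            (MonoidHom.comp_id _).symm h1)) }
  map_id F := by
    ext n : 2
    exact congrArg ModuleCat.ofHom
      (AugTensor.map_eq_id (freeAction_natTrans ς (𝟙 F) n) rfl rfl)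
  map_comp {F G H} η θ := by
    ext n : 2
    exact congrArg ModuleCat.ofHom (AugTensor.map_eq_comp (freeAction_natTrans ς η n)
      (freeAction_natTrans ς θ n) (freeAction_natTrans ς (η ≫ θ) n) rfl rfl)

/-! ### Translation, evanescence and difference functors -/

/-- The translation functor `τ_x`: precomposition with `x ♮ -`. -/
def translation (x : UBeta) : (UBeta ⥤ ModuleCat.{u} K) ⥤ (UBeta ⥤ ModuleCat.{u} K) :=
  (Functor.whiskeringLeft _ _ _).obj (tensorLeft x)

/-- The natural transformation `i_x : Id → τ_x` with `i_x(F)_n = F(ι_x ♮ id_n)`. -/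
def translationUnit (x : UBeta) : 𝟭 (UBeta ⥤ ModuleCat.{u} K) ⟶ translation K x where
  app F := F.leftUnitor.inv ≫ Functor.whiskerRight (unitTensor x) F
  naturality F G η := by
    ext n : 2
    simp [translation]

/-- The evanescence functor `κ_x`, the kernel of `i_x`. -/
def evanescence (x : UBeta) : (UBeta ⥤ ModuleCat.{u} K) ⥤ (UBeta ⥤ ModuleCat.{u} K) :=
  kernel (translationUnit K x)

/-- The difference functor `δ_x`, the cokernel of `i_x`. -/
def difference (x : UBeta) : (UBeta ⥤ ModuleCat.{u} K) ⥤ (UBeta ⥤ ModuleCat.{u} K) :=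
  cokernel (translationUnit K x)

end LongMoodyFunctor

end

end LongMoody

open CategoryTheory CategoryTheory.Limits LongMoody

/-! The augmentation ideal of a free group is a free right module on the elements g_s - 1, so
LM(F)(n) is a sum of n copies of F(1+n) (`AugTensor.piEquiv`). These coordinates are natural in F,
though not in n, and they have two consequences. First, LM is additive and exact, hence commutes
with the kernel and cokernel of i_1. Second, separating the first generator of F_{1+n} = F_1 * F_n
splits τ_1 LM(F)(n) into a copy of F(2+n), carried by g_1 - 1, and a copy of LM(τ_1 F)(n)
(`AugTensor.coprod_bijective`).

The work lies in making this splitting natural in n. On LM(τ_1 F)(n) the group F_n acts through id_1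
♮ ς_n, on the corresponding part of τ_1 LM(F)(n) through ς_{1+n}. The braid b_{1,1}⁻¹ ♮ id_n
intertwines the two by the first coherence condition (`freeAction_swap`), and it is natural by the
Yang–Baxter relation (`swap_naturality`). The summand τ_2 is natural because id_1 ♮ p sends g_1 to
g_1 for every morphism p; this is where reliability enters
(`Reliable.freeHom_id_tensorHom_of_zero`).

Under the splitting, i_1 at LM becomes LM(i_1) followed by the inclusion of the second summand
(`translationUnit_longMoody`). Its cokernel is therefore τ_2 ⊕ coker LM(i_1) and its kernel is ker
LM(i_1); exactness of LM turns these into τ_2 ⊕ LM δ_1 and LM κ_1. -/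

namespace LongMoody

universe u

noncomputable section

/-! ### Fox calculus: the augmentation ideal of a free group is free -/

section Fox

variable {K : Type u} [CommRing K]

theorem sub_algebraMap_mem_augSubmodule {G : Type*} [Group G] (x : MonoidAlgebra K G) :
    x - algebraMap K _ (MonoidAlgebra.lift K K G 1 x) ∈ augSubmodule K G := by
  simp [augSubmodule, LinearMap.mem_ker]

/-- The projection `K[G] → I_{K[G]}`, `x ↦ x - ε(x)`, onto the augmentation ideal. -/
def AugIdeal.proj (G : Type*) [Group G] : MonoidAlgebra K G →ₗ[K] AugIdeal K G :=
  LinearMap.codRestrict (augSubmodule K G)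
    (LinearMap.id - Algebra.linearMap K _ ∘ₗ (MonoidAlgebra.lift K K G 1).toLinearMap)
    (fun x => by
      rw [LinearMap.sub_apply]
      exact sub_algebraMap_mem_augSubmodule x)

theorem AugIdeal.incl_proj {G : Type*} [Group G] (x : MonoidAlgebra K G) :
    (AugIdeal.proj G x).incl = x - algebraMap K _ (MonoidAlgebra.lift K K G 1 x) := rfl

theorem AugIdeal.proj_incl {G : Type*} [Group G] (i : AugIdeal K G) :
    AugIdeal.proj G i.incl = i := by
  refine AugIdeal.ext ?_
  have := i.incl_mem
  simp only [augSubmodule, LinearMap.mem_ker, AlgHom.toLinearMap_apply] at this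
  rw [AugIdeal.incl_proj, this, map_zero, sub_zero]

/-- The element `g - 1` of the augmentation ideal. -/
def AugIdeal.diff {G : Type*} [Group G] (g : G) : AugIdeal K G :=
  AugIdeal.proj G (MonoidAlgebra.of K G g)

theorem AugIdeal.incl_diff {G : Type*} [Group G] (g : G) :
    (AugIdeal.diff g : AugIdeal K G).incl = MonoidAlgebra.of K G g - 1 := by
  rw [AugIdeal.diff, AugIdeal.incl_proj]
  simp [MonoidAlgebra.one_def]

theorem augMap_diff {G H : Type*} [Group G] [Group H] (φ : G →* H) (g : G) :
    augMap φ (AugIdeal.diff g : AugIdeal K G) = AugIdeal.diff (φ g) := by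
  refine AugIdeal.ext ?_
  rw [augMap_incl, AugIdeal.incl_diff, AugIdeal.incl_diff, map_sub, map_one]
  simp

theorem AugIdeal.diff_one {G : Type*} [Group G] : (AugIdeal.diff (1 : G) : AugIdeal K G) = 0 :=
  AugIdeal.ext (by rw [AugIdeal.incl_diff, map_one, sub_self, map_zero])

theorem AugIdeal.diff_mul {G : Type*} [Group G] (g h : G) :
    (AugIdeal.diff (g * h) : AugIdeal K G) =
      (AugIdeal.diff g).mulRight (MonoidAlgebra.of K G h) + AugIdeal.diff h := by
  refine AugIdeal.ext ?_
  have : ((AugIdeal.diff g : AugIdeal K G).mulRight (MonoidAlgebra.of K G h)).incl =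
    (AugIdeal.diff g : AugIdeal K G).incl * (MonoidAlgebra.of K G h) := rfl
  rw [map_add, this, AugIdeal.incl_diff, AugIdeal.incl_diff, AugIdeal.incl_diff, map_mul]
  noncomm_ring

variable {V W : Type u} [AddCommGroup V] [Module K V] [AddCommGroup W] [Module K W]

/-- `i ⊗ v` as a bilinear map. -/
def AugTensor.mk {G : Type*} [Group G] (ρ : G →* Module.End K V) :
    AugIdeal K G →ₗ[K] V →ₗ[K] AugTensor ρ :=
  (TensorProduct.mk K _ _).compr₂ (balancedRel ρ).mkQ

theorem AugTensor.mk_apply {G : Type*} [Group G] (ρ : G →* Module.End K V) (i : AugIdeal K G)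
    (v : V) : AugTensor.mk ρ i v = AugTensor.tmul ρ i v := rfl

theorem AugTensor.tmul_mulRight {G : Type*} [Group G] (ρ : G →* Module.End K V)
    (i : AugIdeal K G) (g : G) (v : V) :
    AugTensor.tmul ρ (i.mulRight (MonoidAlgebra.of K G g)) v = AugTensor.tmul ρ i (ρ g v) := by
  refine (Submodule.Quotient.eq _).2 (Submodule.subset_span ⟨i, MonoidAlgebra.of K G g, v, ?_⟩)
  simp

/-- The map `V^α → I_{K[F_α]} ⊗_{K[F_α]} V`, `w ↦ ∑ (g_s - 1) ⊗ w_s`. -/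
def AugTensor.ofPi {α : Type} [Fintype α] (ρ : FreeGroup α →* Module.End K V) :
    (α → V) →ₗ[K] AugTensor ρ :=
  ∑ s, AugTensor.mk ρ (AugIdeal.diff (FreeGroup.of s)) ∘ₗ LinearMap.proj s

theorem AugTensor.ofPi_apply {α : Type} [Fintype α] (ρ : FreeGroup α →* Module.End K V)
    (w : α → V) :
    AugTensor.ofPi ρ w = ∑ s, AugTensor.tmul ρ (AugIdeal.diff (FreeGroup.of s)) (w s) := by
  simp [AugTensor.ofPi, AugTensor.mk_apply]

variable {α : Type} [DecidableEq α]

/-- The block matrix of the Fox derivatives of the generator `s`. -/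
def foxGen (ρ : FreeGroup α →* Module.End K V) (s : α) : (Module.End K ((α → V) × V))ˣ where
  val := (LinearMap.fst K _ _ + LinearMap.single K (fun _ => V) s ∘ₗ LinearMap.snd K _ _).prod
    (ρ (FreeGroup.of s) ∘ₗ LinearMap.snd K _ _)
  inv := (LinearMap.fst K _ _ - LinearMap.single K (fun _ => V) s ∘ₗ
      ρ (FreeGroup.of s)⁻¹ ∘ₗ LinearMap.snd K _ _).prod
    (ρ (FreeGroup.of s)⁻¹ ∘ₗ LinearMap.snd K _ _)
  val_inv := by
    have h : ∀ v, ρ (FreeGroup.of s) (ρ (FreeGroup.of s)⁻¹ v) = v := fun v => by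
      rw [← Module.End.mul_apply, ← map_mul, mul_inv_cancel, map_one, Module.End.one_apply]
    refine LinearMap.ext fun x => Prod.ext ?_ ?_ <;> simp [h]
  inv_val := by
    have h : ∀ v, ρ (FreeGroup.of s)⁻¹ (ρ (FreeGroup.of s) v) = v := fun v => by
      rw [← Module.End.mul_apply, ← map_mul, inv_mul_cancel, map_one, Module.End.one_apply]
    refine LinearMap.ext fun x => Prod.ext ?_ ?_ <;> simp [h]

/-- The representation of a free group on `V^α × V` whose off-diagonal block is given by the
Fox derivatives. -/
def foxRep (ρ : FreeGroup α →* Module.End K V) : FreeGroup α →* Module.End K ((α → V) × V) :=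
  (Units.coeHom _).comp (FreeGroup.lift (foxGen ρ))

theorem foxRep_of (ρ : FreeGroup α →* Module.End K V) (s : α) (x : (α → V) × V) :
    foxRep ρ (FreeGroup.of s) x = (x.1 + Pi.single s x.2, ρ (FreeGroup.of s) x.2) := by
  simp [foxRep, foxGen]

/-- With `foxRep_snd` this shows that g acts by a block triangular matrix with diagonal blocks 1 and
ρ(g). The product rule for the off-diagonal block is then matrix multiplication. -/
theorem foxRep_inl (ρ : FreeGroup α →* Module.End K V) (g : FreeGroup α) (w : α → V) :
    foxRep ρ g (w, 0) = (w, 0) := by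
  induction g using FreeGroup.induction_on with
  | C1 => rw [map_one]; rfl
  | of s => rw [foxRep_of]; simp
  | inv_of s h =>
    -- The vector is replaced by its image under the generator, which the inverse cancels.
    nth_rw 1 [← h]
    rw [← Module.End.mul_apply, ← map_mul, inv_mul_cancel, map_one, Module.End.one_apply]
  | mul x y hx hy => rw [map_mul, Module.End.mul_apply, hy, hx]

theorem foxRep_snd (ρ : FreeGroup α →* Module.End K V) (g : FreeGroup α) (x : (α → V) × V) :
    (foxRep ρ g x).2 = ρ g x.2 := by
  induction g using FreeGroup.induction_on generalizing x with
  | C1 => rw [map_one, map_one]; rfl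
  | of s => rw [foxRep_of]
  | inv_of s h =>
    have h1 := h (foxRep ρ (FreeGroup.of s)⁻¹ x)
    rw [← Module.End.mul_apply (foxRep ρ _), ← map_mul, mul_inv_cancel, map_one,
      Module.End.one_apply] at h1
    rw [h1, ← Module.End.mul_apply, ← map_mul, inv_mul_cancel, map_one, Module.End.one_apply]
  | mul x y hx hy => rw [map_mul, Module.End.mul_apply, hx, hy, map_mul, Module.End.mul_apply]

theorem lift_foxRep_inl (ρ : FreeGroup α →* Module.End K V) (x : MonoidAlgebra K (FreeGroup α))
    (w : α → V) :
    MonoidAlgebra.lift K _ _ (foxRep ρ) x (w, 0) = MonoidAlgebra.lift K K _ 1 x • (w, 0) := by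
  induction x using MonoidAlgebra.induction_linear with
  | zero => simp
  | add x y hx hy => simp only [map_add, LinearMap.add_apply, hx, hy, add_smul]
  | single g r => simp [foxRep_inl]

theorem lift_foxRep_snd (ρ : FreeGroup α →* Module.End K V) (x : MonoidAlgebra K (FreeGroup α))
    (y : (α → V) × V) :
    (MonoidAlgebra.lift K _ _ (foxRep ρ) x y).2 = MonoidAlgebra.lift K _ _ ρ x y.2 := by
  induction x using MonoidAlgebra.induction_linear with
  | zero => simp
  | add x y hx hy => simp only [map_add, LinearMap.add_apply, hx, hy, Prod.snd_add]
  | single g r => simp [foxRep_snd]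

/-- The Fox derivatives `K[F_α] × V → V^α`. -/
def foxDeriv (ρ : FreeGroup α →* Module.End K V) :
    MonoidAlgebra K (FreeGroup α) →ₗ[K] V →ₗ[K] (α → V) :=
  ((LinearMap.llcomp K _ _ _ (LinearMap.fst K (α → V) V)) ∘ₗ
    (MonoidAlgebra.lift K _ _ (foxRep ρ)).toLinearMap).compl₂ (LinearMap.inr K (α → V) V)

theorem foxDeriv_apply (ρ : FreeGroup α →* Module.End K V) (x : MonoidAlgebra K (FreeGroup α))
    (v : V) : foxDeriv ρ x v = (MonoidAlgebra.lift K _ _ (foxRep ρ) x (0, v)).1 := rfl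

/-- This is the off-diagonal block of a product of block triangular matrices. When x lies in the
augmentation ideal the first term vanishes, and what remains is the balancing relation that lets the
Fox derivatives descend to the tensor product. -/
theorem foxDeriv_mul (ρ : FreeGroup α →* Module.End K V) (x y : MonoidAlgebra K (FreeGroup α))
    (v : V) : foxDeriv ρ (x * y) v = MonoidAlgebra.lift K K _ 1 x • foxDeriv ρ y v +
      foxDeriv ρ x (MonoidAlgebra.lift K _ _ ρ y v) := by
  simp only [foxDeriv_apply, map_mul, Module.End.mul_apply]
  rw [← lift_foxRep_snd ρ y (0, v)]
  generalize MonoidAlgebra.lift K _ _ (foxRep ρ) y (0, v) = z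
  -- On the first component x acts by its augmentation, on the second by its Fox derivatives.
  have : z = (z.1, 0) + (0, z.2) := by simp
  nth_rw 1 [this]
  rw [map_add, lift_foxRep_inl]
  rfl

/-- The map `I_{K[F_α]} ⊗_{K[F_α]} V → V^α` given by the Fox derivatives. -/
def AugTensor.fox (ρ : FreeGroup α →* Module.End K V) : AugTensor ρ →ₗ[K] (α → V) :=
  (balancedRel ρ).liftQ (TensorProduct.lift (foxDeriv ρ ∘ₗ AugIdeal.incl)) (by
    rw [balancedRel, Submodule.span_le]
    rintro _ ⟨i, x, v, rfl⟩
    have hi := i.incl_mem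
    have hx : (i.mulRight x).incl = i.incl * x := rfl
    simp only [augSubmodule, LinearMap.mem_ker, AlgHom.toLinearMap_apply] at hi
    simp only [SetLike.mem_coe, LinearMap.mem_ker, map_sub, TensorProduct.lift.tmul,
      LinearMap.comp_apply, hx, foxDeriv_mul, hi, zero_smul, zero_add, sub_self])

theorem AugTensor.fox_tmul (ρ : FreeGroup α →* Module.End K V) (i : AugIdeal K (FreeGroup α))
    (v : V) : AugTensor.fox ρ (AugTensor.tmul ρ i v) = foxDeriv ρ i.incl v := rfl

theorem foxDeriv_of (ρ : FreeGroup α →* Module.End K V) (g : FreeGroup α) (v : V) :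
    foxDeriv ρ (MonoidAlgebra.of K _ g) v = (foxRep ρ g (0, v)).1 := by
  simp [foxDeriv_apply]

theorem foxDeriv_one (ρ : FreeGroup α →* Module.End K V) (v : V) : foxDeriv ρ 1 v = 0 := by
  rw [foxDeriv_apply, map_one]; rfl

variable [Fintype α]

theorem AugTensor.fox_ofPi (ρ : FreeGroup α →* Module.End K V) (w : α → V) :
    AugTensor.fox ρ (AugTensor.ofPi ρ w) = w := by
  rw [AugTensor.ofPi_apply, map_sum]
  simp only [AugTensor.fox_tmul, AugIdeal.incl_diff, map_sub, LinearMap.sub_apply, foxDeriv_one,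
    foxDeriv_of, foxRep_of, sub_zero, zero_add]
  exact Finset.univ_sum_single w

/-- The fundamental formula of Fox calculus, g - 1 = ∑ (g_s - 1) ∂_s g. Both sides obey the same
product rule and agree on generators. -/
theorem AugTensor.ofPi_foxDeriv_of (ρ : FreeGroup α →* Module.End K V) (g : FreeGroup α)
    (v : V) : AugTensor.ofPi ρ (foxDeriv ρ (MonoidAlgebra.of K _ g) v) =
      AugTensor.tmul ρ (AugIdeal.diff g) v := by
  -- The difference of the two sides is a cocycle, so it vanishes on all words once it vanishes on
  -- generators.
  have key : ∀ (x y : FreeGroup α) (v : V),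
      AugTensor.ofPi ρ (foxDeriv ρ (MonoidAlgebra.of K _ (x * y)) v) -
        AugTensor.tmul ρ (AugIdeal.diff (x * y)) v =
      (AugTensor.ofPi ρ (foxDeriv ρ (MonoidAlgebra.of K _ x) (ρ y v)) -
        AugTensor.tmul ρ (AugIdeal.diff x) (ρ y v)) +
      (AugTensor.ofPi ρ (foxDeriv ρ (MonoidAlgebra.of K _ y) v) -
        AugTensor.tmul ρ (AugIdeal.diff y) v) := by
    intro x y v
    rw [map_mul, foxDeriv_mul, AugIdeal.diff_mul, map_add, ← AugTensor.mk_apply,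
      map_add (AugTensor.mk ρ), LinearMap.add_apply, AugTensor.mk_apply, AugTensor.mk_apply,
      AugTensor.tmul_mulRight]
    simp only [MonoidAlgebra.of_apply, MonoidAlgebra.lift_single, MonoidHom.one_apply, smul_eq_mul,
      mul_one, one_smul]
    abel
  have h1 : ∀ v : V, AugTensor.ofPi ρ (foxDeriv ρ (MonoidAlgebra.of K _ 1) v) -
        AugTensor.tmul ρ (AugIdeal.diff 1) v = 0 := by
    intro v
    rw [map_one, foxDeriv_one, AugIdeal.diff_one, ← AugTensor.mk_apply]
    simp
  rw [← sub_eq_zero]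
  induction g using FreeGroup.induction_on generalizing v with
  | C1 => exact h1 v
  | of s =>
    rw [AugTensor.ofPi_apply, foxDeriv_of, foxRep_of, sub_eq_zero,
      Finset.sum_eq_single_of_mem s (Finset.mem_univ s)]
    · simp
    · intro t _ ht
      simp only [zero_add, Pi.single_eq_of_ne ht]
      rw [← AugTensor.mk_apply, map_zero]
  | inv_of s h =>
    -- The cocycle vanishes on 1 = s s⁻¹ and on s, hence on s⁻¹.
    have := key (FreeGroup.of s) (FreeGroup.of s)⁻¹ v
    rw [mul_inv_cancel, h1, h, zero_add] at this
    exact this.symm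
  | mul x y hx hy => rw [key, hx, hy, add_zero]

theorem AugTensor.ofPi_fox (ρ : FreeGroup α →* Module.End K V) (x : AugTensor ρ) :
    AugTensor.ofPi ρ (AugTensor.fox ρ x) = x := by
  suffices h : AugTensor.ofPi ρ ∘ₗ AugTensor.fox ρ = LinearMap.id from DFunLike.congr_fun h x
  refine AugTensor.hom_ext fun i v => ?_
  -- The identity is extended from the augmentation ideal to the whole group ring by means of x ↦ x
  -- - ε(x), so that it can be tested on group elements.
  have key : AugTensor.ofPi ρ ∘ₗ (foxDeriv ρ).flip v =
      (AugTensor.mk ρ).flip v ∘ₗ AugIdeal.proj _ :=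
    MonoidAlgebra.lhom_ext' fun g => LinearMap.ext_ring (AugTensor.ofPi_foxDeriv_of ρ g v)
  have := DFunLike.congr_fun key i.incl
  simp only [LinearMap.comp_apply, AugIdeal.proj_incl] at this
  exact this

/-- `I_{K[F_α]} ⊗_{K[F_α]} V` is isomorphic to `V^α`, since `I_{K[F_α]}` is free on the
elements `g_s - 1`. -/
def AugTensor.piEquiv (ρ : FreeGroup α →* Module.End K V) : (α → V) ≃ₗ[K] AugTensor ρ where
  __ := AugTensor.ofPi ρ
  invFun := AugTensor.fox ρ
  left_inv := AugTensor.fox_ofPi ρ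
  right_inv := AugTensor.ofPi_fox ρ

theorem AugTensor.piEquiv_apply (ρ : FreeGroup α →* Module.End K V) (w : α → V) :
    AugTensor.piEquiv ρ w = ∑ s, AugTensor.tmul ρ (AugIdeal.diff (FreeGroup.of s)) (w s) :=
  AugTensor.ofPi_apply ρ w

/-- In the free coordinates a change of coefficients acts componentwise; additivity and exactness of
LM both rest on this. -/
theorem AugTensor.map_id_piEquiv {ρ : FreeGroup α →* Module.End K V}
    {ρ' : FreeGroup α →* Module.End K W} (T : V →ₗ[K] W)
    (hT : ∀ g v, T (ρ g v) = ρ' (MonoidHom.id _ g) (T v)) (w : α → V) :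
    AugTensor.map (MonoidHom.id _) T hT (AugTensor.piEquiv ρ w) =
      AugTensor.piEquiv ρ' (fun s => T (w s)) := by
  simp only [AugTensor.piEquiv_apply, map_sum, AugTensor.map_tmul, augMap_id]

/-- The decomposition `I_{K[F_{1+n}]} ⊗ W ≅ W ⊕ (I_{K[F_n]} ⊗ W)`. -/
theorem AugTensor.coprod_bijective {n : ℕ} {U : Type u} [AddCommGroup U] [Module K U]
    {ρ : FreeGroup (Fin n) →* Module.End K V} {ρ' : FreeGroup (Fin (1 + n)) →* Module.End K W}
    (S : U →ₗ[K] W) (hS : Function.Bijective S) (T : V →ₗ[K] W) (hT : Function.Bijective T)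
    (hρ : ∀ g v, T (ρ g v) = ρ' (freeShift 1 le_rfl g) (T v)) :
    Function.Bijective ((AugTensor.mk ρ' (AugIdeal.diff (FreeGroup.of ⟨0, by omega⟩)) ∘ₗ S).coprod
      (AugTensor.map (freeShift 1 le_rfl) T hρ)) := by
  -- In free coordinates the map prepends S(u), as the coefficient of g_1, to the family T(w_s). The
  -- reindexing passes from n + 1, produced by `Fin.consEquiv`, to 1 + n.
  let e : (U × (Fin n → V)) ≃ (Fin (1 + n) → W) :=
    ((Equiv.ofBijective S hS).prodCongr (Equiv.piCongrRight fun _ => Equiv.ofBijective T hT)).trans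
      ((Fin.consEquiv fun _ => W).trans
        (Equiv.piCongrLeft (fun _ => W) (finCongr (Nat.add_comm n 1))))
  let e' : (U × (Fin n → V)) ≃ U × AugTensor ρ :=
    (Equiv.refl U).prodCongr (AugTensor.piEquiv ρ).toEquiv
  suffices h : ∀ x, ((AugTensor.mk ρ' (AugIdeal.diff (FreeGroup.of ⟨0, by omega⟩)) ∘ₗ S).coprod
      (AugTensor.map (freeShift 1 le_rfl) T hρ)) (e' x) = AugTensor.piEquiv ρ' (e x) by
    rw [← e'.bijective.of_comp_iff, show _ ∘ e' = AugTensor.piEquiv ρ' ∘ e from funext h]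
    exact (AugTensor.piEquiv ρ').bijective.comp e.bijective
  rintro ⟨u, w⟩
  simp only [e', e, LinearMap.coprod_apply, Equiv.prodCongr_apply, Prod.map, Equiv.refl_apply,
    LinearEquiv.coe_toEquiv, LinearMap.comp_apply, AugTensor.mk_apply, AugTensor.piEquiv_apply,
    map_sum, AugTensor.map_tmul, augMap_diff, freeShift, FreeGroup.map.of]
  rw [← (finCongr (Nat.add_comm n 1)).sum_comp, Fin.sum_univ_succ]
  congr 1
  refine Finset.sum_congr rfl fun s _ => ?_
  congr 3
  exact Fin.ext (Nat.add_comm 1 _)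

end Fox

/-! ### The Yang–Baxter relation in braid groups -/

namespace BraidGroup

theorem braiding_one (k : ℕ) : braiding 1 k = strandBraiding k := by
  simp [braiding, shift_zero]

theorem braiding_one_one : braiding 1 1 = gen 0 (by omega) := by
  simp [braiding_one, strandBraiding]

/-- The Yang–Baxter relation for the crossings of two strands with `k` strands:
`(id_k ♮ b_{1,1}) ∘ (b_{1,k} ♮ id_1) ∘ (id_1 ♮ b_{1,k}) =
(b_{1,k} ♮ id_1) ∘ (id_1 ♮ b_{1,k}) ∘ (b_{1,1} ♮ id_k)`. -/
theorem strandBraiding_yangBaxter (k : ℕ) {N : ℕ} (h : k + 2 ≤ N) :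
    gen (n := N) k (by omega) * shift 0 (by omega) (strandBraiding k) *
        shift 1 (by omega) (strandBraiding k) =
      shift 0 (by omega) (strandBraiding k) * shift 1 (by omega) (strandBraiding k) *
        gen 0 (by omega) := by
  -- The braid b_{1,k+1} factors by splitting off either its last or its first crossing; naturality
  -- of b_{1,k+1} with respect to the braid b_{1,k} itself compares the two.
  have e1 := strandBraiding_succ k
  have e2 := strandBraiding_add 1 k
  have e3 := strandBraiding_natural (1 + k) (strandBraiding k)
  have h1 : strandBraiding 1 = gen 0 (by omega) := by simp [strandBraiding]
  rw [h1, shift_gen] at e2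
  have e1' := congrArg (shift (N := N) 0 (by omega)) e1
  have e2' := congrArg (shift (N := N) 0 (by omega)) e2
  have e3' := congrArg (shift (N := N) 0 (by omega)) e3
  simp only [map_mul, shift_shift, shift_gen, Nat.zero_add, Nat.add_zero] at e1' e2' e3'
  have e4 : ∀ m m' (hm : m = m') (h : 0 + (1 + m) ≤ N), shift 0 h (strandBraiding m) =
      shift (N := N) 0 (by omega) (strandBraiding m') := by
    rintro m _ rfl _; rfl
  rw [← e1', e4 _ _ (Nat.add_comm k 1), e3', e2', mul_assoc]

theorem eq_one_of_le_one {n : ℕ} (h : n ≤ 1) (g : BraidGroup n) : g = 1 := by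
  induction g using induction_on with
  | hg i hi => omega
  | h1 => rfl
  | hm x y hx hy => rw [hx, hy, one_mul]
  | hi x hx => rw [hx, inv_one]

end BraidGroup

open BraidGroup UBeta

/-! ### The exchange of the first two strands in 𝔘β -/

namespace UBeta

/-- The automorphism `b_{1,1}⁻¹ ♮ id_n` of `1 ♮ 1 ♮ n`. -/
def swap (n : UBeta) : tensorObj (of 1) (tensorObj (of 1) n) ⟶
    tensorObj (of 1) (tensorObj (of 1) n) :=
  aut (tensorObj (of 1) (tensorObj (of 1) n)) (gen 0 (by change _ < 1 + (1 + _); omega))⁻¹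

theorem unitTensor_app_eq (x n : UBeta) :
    (unitTensor x).app n = homMk x.strands rfl 1 := leftUnit_comp x n

/-- The left side adds a strand in second position, the right side in first position. The correction
is the b_{1,1}⁻¹ in the definition of the product on morphisms, and it is why the splitting must
involve a braid. -/
theorem id_tensorHom_unitTensor (n : UBeta) :
    tensorHom (𝟙 (of 1)) ((unitTensor (of 1)).app n) =
      (unitTensor (of 1)).app (tensorObj (of 1) n) ≫ swap n := by
  rw [unitTensor_app_eq, unitTensor_app_eq]
  refine (id_tensorHom_homMk _ _ _).trans (Eq.trans ?_ (homMk_comp_homMk ..).symm)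
  refine homMk_congr ?_
  change (shift 1 _ (1 : BraidGroup (1 + n.strands)) * shift 0 _ (braiding 1 1)⁻¹ :
      BraidGroup (1 + (1 + n.strands))) =
    (gen 0 _)⁻¹ * shift 0 _ (1 : BraidGroup (1 + (1 + n.strands)))
  refine (congrArg₂ (· * ·) (map_one _) (map_inv _ _)).trans
    (Eq.trans ?_ (congrArg _ (map_one _)).symm)
  rw [braiding_one_one, shift_gen]
  exact (one_mul _).trans (mul_one _).symm

/-- For p = [k, f], the braid f lies on strands beyond the first two and so commutes with the
crossing; the remaining factors b_{1,k}⁻¹ are handled by the inverted Yang–Baxter relation. -/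
theorem swap_naturality {n n' : UBeta} (p : n ⟶ n') :
    swap n ≫ tensorHom (𝟙 (of 1)) (tensorHom (𝟙 (of 1)) p) =
      tensorHom (𝟙 (of 1)) (tensorHom (𝟙 (of 1)) p) ≫ swap n' := by
  induction p using hom_ind with
  | h k e f =>
    rw [id_tensorHom_homMk]
    erw [id_tensorHom_homMk]
    refine (homMk_comp_homMk ..).trans (Eq.trans ?_ (homMk_comp_homMk ..).symm)
    refine homMk_congr ?_
    have hc : Commute (gen 0 (by omega))
        (shift (N := 1 + (1 + n'.strands)) 2 (by omega) f) := by
      have := shift_commute (N := 1 + (1 + n'.strands)) (c := 0) (d := 2) (m := 2) (by omega)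
        (by omega) (by omega) (gen 0 (by omega)) f
      rwa [shift_gen] at this
    have hY := congrArg (·⁻¹) (strandBraiding_yangBaxter k (N := 1 + (1 + n'.strands)) (by omega))
    simp only [mul_inv_rev] at hY
    simp only [braiding_one, map_mul, map_inv, shift_gen, shift_shift, Nat.zero_add,
      Nat.add_zero, Nat.reduceAdd, mul_assoc]
    rw [hY, ← mul_assoc, ← mul_assoc, ← hc.inv_left.eq, mul_assoc, mul_assoc]

instance isIso_aut (n : UBeta) (σ : BraidGroup n.strands) : IsIso (C := UBeta) (aut n σ) := by
  refine ⟨aut n σ⁻¹, ?_, ?_⟩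
  · rw [← End.mul_def, ← map_mul, inv_mul_cancel, map_one, End.one_def]
  · rw [← End.mul_def, ← map_mul, mul_inv_cancel, map_one, End.one_def]

instance (n : UBeta) : IsIso (swap n) := isIso_aut _ _

/-- A morphism n → 1 + n determines its representing braid, since the ambiguity is an element of the
trivial group B_1. -/
theorem unitTensor_one_cancel {n : UBeta} {p q : tensorObj (of 1) n ⟶ tensorObj (of 1) n}
    (h : (unitTensor (of 1)).app n ≫ p = (unitTensor (of 1)).app n ≫ q) : p = q := by
  induction p using hom_ind with
  | h k e f =>
  induction q using hom_ind with
  | h l e' f' =>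
    obtain rfl : k = 0 := by omega
    obtain rfl : l = 0 := by omega
    rw [unitTensor_app_eq] at h
    obtain ⟨g, hg⟩ := Quotient.exact
      ((homMk_comp_homMk ..).symm.trans (h.trans (homMk_comp_homMk ..)))
    have hg1 : g = 1 := BraidGroup.eq_one_of_le_one (by change 0 + 1 ≤ 1; omega) g
    subst hg1
    refine homMk_congr ?_
    refine (mul_one f).symm.trans (((congrArg (f * ·) (map_one _)).symm.trans hg).trans ?_)
    exact (congrArg₂ (· * ·) (congrArg (f' * ·) (map_one _)) (map_one _)).trans
      ((mul_one _).trans (mul_one _))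

/-- The associativity isomorphism `2 ♮ n ≅ 1 ♮ (1 ♮ n)`. -/
def assocTwo (n : UBeta) : tensorObj (of 2) n ≅ tensorObj (of 1) (tensorObj (of 1) n) where
  hom := homMk 0 (by change 0 + (2 + _) = 1 + (1 + _); omega) 1
  inv := homMk 0 (by change 0 + (1 + (1 + _)) = 2 + _; omega) 1
  hom_inv_id := by
    refine (homMk_comp_homMk ..).trans (homMk_congr ?_)
    simp
  inv_hom_id := by
    refine (homMk_comp_homMk ..).trans (homMk_congr ?_)
    simp

/-- The isomorphism carries the identity braid, so this amounts to b_{2,k} = (b_{1,k} ♮ id_1) ∘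
(id_1 ♮ b_{1,k}). -/
theorem assocTwo_naturality {n n' : UBeta} (p : n ⟶ n') :
    tensorHom (𝟙 (of 2)) p ≫ (assocTwo n').hom =
      (assocTwo n).hom ≫ tensorHom (𝟙 (of 1)) (tensorHom (𝟙 (of 1)) p) := by
  induction p using hom_ind with
  | h k e f =>
    rw [id_tensorHom_homMk, id_tensorHom_homMk]
    erw [id_tensorHom_homMk]
    refine (homMk_comp_homMk ..).trans (Eq.trans ?_ (homMk_comp_homMk ..).symm)
    refine homMk_congr ?_
    simp only [braiding_succ, braiding_zero, map_mul, map_inv, map_one, shift_shift, Nat.zero_add,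
      Nat.add_zero, Nat.reduceAdd, one_mul, mul_one, mul_inv_rev, mul_assoc]

end UBeta

/-! ### Kernels and cokernels of maps into one summand -/

section Abelian

variable {C : Type*} [Category* C] [Abelian C] {X Y A B : C}

/-- The cokernel of `inr ∘ g : X ⟶ A ⊞ B ≅ Y` is `A ⊞ coker g`. -/
def cokernelIsoBiprod (f : X ⟶ Y) (g : X ⟶ B) (e : A ⊞ B ≅ Y)
    (w : (g ≫ biprod.inr) ≫ e.hom = f) : cokernel f ≅ A ⊞ cokernel g where
  hom := cokernel.desc _ (e.inv ≫ biprod.map (𝟙 A) (cokernel.π g)) (by simp [← w])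
  inv := biprod.desc (biprod.inl ≫ e.hom ≫ cokernel.π _)
    (cokernel.desc g (biprod.inr ≫ e.hom ≫ cokernel.π _) (by
      rw [← Category.assoc, ← Category.assoc, w, cokernel.condition]))
  hom_inv_id := by
    ext
    simp only [cokernel.π_desc_assoc, Category.assoc, Category.comp_id, Iso.inv_comp_eq]
    ext <;> simp

/-- The kernel of `inr ∘ g : X ⟶ A ⊞ B ≅ Y` is `ker g`. -/
def kernelIsoOfBiprod (f : X ⟶ Y) (g : X ⟶ B) (e : A ⊞ B ≅ Y)
    (w : (g ≫ biprod.inr) ≫ e.hom = f) : kernel f ≅ kernel g :=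
  kernelIsoOfEq (w.symm.trans (Category.assoc _ _ _)) ≪≫ kernelCompMono g (biprod.inr ≫ e.hom)

end Abelian

/-! ### Exactness of the Long–Moody functor -/

section Exact

variable (K : Type u) [CommRing K]
  {ς : ∀ n : ℕ, FreeGroup (Fin n) →* BraidGroup (1 + n)}
  {a : ∀ n : ℕ, BraidGroup n →* MulAut (FreeGroup (Fin n))}

theorem longMoody_map_app_piEquiv (hc : Coherent ς a) {F G : UBeta ⥤ ModuleCat.{u} K}
    (η : F ⟶ G) (n : UBeta) (w : Fin n.strands → F.obj (tensorObj (.of 1) n)) :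
    (((longMoody K hc).map η).app n).hom (AugTensor.piEquiv (freeAction ς F n) w) =
      AugTensor.piEquiv (freeAction ς G n) fun s => (η.app (tensorObj (.of 1) n)).hom (w s) :=
  AugTensor.map_id_piEquiv _ (freeAction_natTrans ς η n) w

instance (hc : Coherent ς a) : (longMoody K hc).Additive where
  map_add {F G f g} := by
    ext n : 2
    refine ModuleCat.hom_ext (LinearMap.ext fun x => ?_)
    obtain ⟨w, rfl⟩ := (AugTensor.piEquiv (freeAction ς F n)).surjective x
    refine (longMoody_map_app_piEquiv K hc _ n w).trans (Eq.trans ?_ (congrArg₂ (· + ·)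
      (longMoody_map_app_piEquiv K hc f n w) (longMoody_map_app_piEquiv K hc g n w)).symm)
    exact map_add (AugTensor.piEquiv (freeAction ς G n))
      (fun s => (f.app (tensorObj (.of 1) n)).hom (w s))
      (fun s => (g.app (tensorObj (.of 1) n)).hom (w s))

/-- In free coordinates the sequence at n is an n-fold power of the original sequence evaluated at 1
+ n. -/
theorem longMoody_evaluation_exact (hc : Coherent ς a) (n : UBeta)
    (S : ShortComplex (UBeta ⥤ ModuleCat.{u} K)) (hS : S.Exact) :
    (S.map (longMoody K hc ⋙ (evaluation _ _).obj n)).Exact := by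
  have h := hS.map ((evaluation _ (ModuleCat.{u} K)).obj (tensorObj (.of 1) n))
  rw [ShortComplex.moduleCat_exact_iff] at h ⊢
  intro x hx
  obtain ⟨w, rfl⟩ := (AugTensor.piEquiv (freeAction ς S.X₂ n)).surjective x
  have hx' := (longMoody_map_app_piEquiv K hc S.g n w).symm.trans hx
  have hx'' := (AugTensor.piEquiv (freeAction ς S.X₃ n)).injective (hx'.trans (map_zero _).symm)
  -- Preimages are chosen one coordinate at a time.
  choose v hv using fun s => h (w s) (congrFun hx'' s)
  refine ⟨AugTensor.piEquiv (freeAction ς S.X₁ n) v, ?_⟩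
  refine (longMoody_map_app_piEquiv K hc S.f n v).trans ?_
  exact congrArg _ (funext hv)

theorem longMoody_evaluation_preserves (hc : Coherent ς a) (n : UBeta) :
    PreservesFiniteLimits (longMoody K hc ⋙ (evaluation _ (ModuleCat.{u} K)).obj n) ∧
      PreservesFiniteColimits (longMoody K hc ⋙ (evaluation _ (ModuleCat.{u} K)).obj n) :=
  ((Functor.exact_tfae _).out 1 3).1 (longMoody_evaluation_exact K hc n)

instance (hc : Coherent ς a) :
    PreservesLimitsOfShape WalkingParallelPair (longMoody K hc) :=
  preservesLimitsOfShape_of_evaluation _ _ fun n =>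
    have := (longMoody_evaluation_preserves K hc n).1
    inferInstance

instance (hc : Coherent ς a) :
    PreservesColimitsOfShape WalkingParallelPair (longMoody K hc) :=
  preservesColimitsOfShape_of_evaluation _ _ fun n =>
    have := (longMoody_evaluation_preserves K hc n).2
    inferInstance

end Exact

/-! ### Composition of functors with kernels and cokernels -/

section Whiskering

variable {C D E : Type*} [Category* C] [Category* D] [Category* E] [Abelian E]

/-- Precomposition commutes with kernels of natural transformations. -/
def whiskerLeftKernel (L : C ⥤ D) {F G : D ⥤ E} (α : F ⟶ G) :
    L ⋙ kernel α ≅ kernel (Functor.whiskerLeft L α) :=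
  PreservesKernel.iso ((Functor.whiskeringLeft C D E).obj L) α

/-- Precomposition commutes with cokernels of natural transformations. -/
def whiskerLeftCokernel (L : C ⥤ D) {F G : D ⥤ E} (α : F ⟶ G) :
    L ⋙ cokernel α ≅ cokernel (Functor.whiskerLeft L α) :=
  PreservesCokernel.iso ((Functor.whiskeringLeft C D E).obj L) α

variable [Abelian D] (L : D ⥤ E) [L.Additive]

/-- Composition with a left exact functor commutes with kernels of natural transformations. -/
def whiskerRightKernel [PreservesLimitsOfShape WalkingParallelPair L] {F G : C ⥤ D}
    (α : F ⟶ G) : kernel α ⋙ L ≅ kernel (Functor.whiskerRight α L) :=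
  PreservesKernel.iso ((Functor.whiskeringRight C D E).obj L) α

/-- Composition with a right exact functor commutes with cokernels of natural
transformations. -/
def whiskerRightCokernel [PreservesColimitsOfShape WalkingParallelPair L] {F G : C ⥤ D}
    (α : F ⟶ G) : cokernel α ⋙ L ≅ cokernel (Functor.whiskerRight α L) :=
  PreservesCokernel.iso ((Functor.whiskeringRight C D E).obj L) α

end Whiskering

/-! ### The splitting and its naturality -/

section Splitting

variable (K : Type u) [CommRing K]
  {ς : ∀ n : ℕ, FreeGroup (Fin n) →* BraidGroup (1 + n)}
  {a : ∀ n : ℕ, BraidGroup n →* MulAut (FreeGroup (Fin n))}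

theorem Coherent.freeHom_unitTensor (hc : Coherent ς a) (n : UBeta) :
    hc.freeHom ((unitTensor (.of 1)).app n) = freeShift 1 le_rfl := by
  rw [unitTensor_app_eq]
  refine MonoidHom.ext fun g => ?_
  exact DFunLike.congr_fun (map_one (a (1 + n.strands))) _

/-- The assignment n ↦ F_n is a functor on 𝔘β that sends ι_1 ♮ id_n to the shift by one; applying it
to the naturality square of ι_1 ♮ - gives the claim. -/
theorem Coherent.freeHom_id_tensorHom_shift (hc : Coherent ς a) {n n' : UBeta} (p : n ⟶ n') :
    (hc.freeHom (tensorHom (𝟙 (UBeta.of 1)) p)).comp (freeShift 1 le_rfl) =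
      (freeShift 1 le_rfl).comp (hc.freeHom p) := by
  have h := congrArg hc.freeHom ((unitTensor (.of 1)).naturality p)
  have h1 := hc.freeHom_comp p ((unitTensor (.of 1)).app n')
  have h2 := hc.freeHom_comp ((unitTensor (.of 1)).app n) (tensorHom (𝟙 (UBeta.of 1)) p)
  rw [hc.freeHom_unitTensor] at h1 h2
  exact (h1.symm.trans (h.trans h2)).symm

theorem Reliable.freeHom_id_tensorHom_of_zero (hr : Reliable ς a) {n n' : UBeta} (p : n ⟶ n') :
    hr.toCoherent.freeHom (tensorHom (𝟙 (UBeta.of 1)) p)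
        (FreeGroup.of (⟨0, by change 0 < 1 + _; omega⟩ : Fin (tensorObj (.of 1) n).strands)) =
      FreeGroup.of (⟨0, by change 0 < 1 + _; omega⟩ : Fin (tensorObj (.of 1) n').strands) := by
  induction p using hom_ind with
  | h k e f =>
    rw [id_tensorHom_homMk, hr.toCoherent.freeHom_homMk, map_mul, MulAut.mul_apply]
    -- The shift sends g_1 to g_{1+k}, the factor b_{1,k}⁻¹ brings it back to g_1, and id_1 ♮ f then
    -- fixes g_1.
    have h4 := hr.action_braiding k n.strands n'.strands e (FreeGroup.of 0)
    have h5 := hr.action_stabilizer 1 n'.strands f (FreeGroup.of 0)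
    rw [tensor, map_one, one_mul] at h5
    exact (congrArg _ h4).trans h5

/-- Conjugation by `b_{1,1}⁻¹ ♮ id_n` identifies the actions of `F_n` through
`id_1 ♮ ς_n` and through `ς_{1+n}`. -/
theorem freeAction_swap (hc : Coherent ς a) (F : UBeta ⥤ ModuleCat.{u} K) (n : UBeta)
    (g : FreeGroup (Fin n.strands)) (v : F.obj (tensorObj (.of 1) (tensorObj (.of 1) n))) :
    (F.map (swap n)).hom (freeAction ς ((translation K (.of 1)).obj F) n g v) =
      freeAction ς F (tensorObj (.of 1) n) (freeShift 1 le_rfl g) ((F.map (swap n)).hom v) := by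
  have h : tensorHom (𝟙 (UBeta.of 1)) (aut (tensorObj (.of 1) n) (ς n.strands g)) ≫ swap n =
      swap n ≫ aut (tensorObj (.of 1) (tensorObj (.of 1) n))
        (ς (1 + n.strands) (freeShift 1 le_rfl g)) := by
    -- Precomposed with ι_1 ♮ id, the identity becomes the first coherence condition for n ≤ 1 + n,
    -- because id_1 ♮ (ι_1 ♮ id_n) is ι_1 ♮ id_{1+n} followed by the exchange.
    refine unitTensor_one_cancel ?_
    have h1 := (unitTensor (.of 1)).naturality
      (aut (tensorObj (.of 1) n) (ς n.strands g) : tensorObj (.of 1) n ⟶ tensorObj (.of 1) n)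
    have h2 := hc.stability 1 n.strands (1 + n.strands) rfl g
    have h3 := id_tensorHom_unitTensor n
    replace h3 := (congrArg (tensorHom (𝟙 (UBeta.of 1)))
      (unitTensor_app_eq (.of 1) n).symm).trans h3
    erw [h3] at h2
    erw [← Category.assoc, ← h1, Category.assoc, h2, Category.assoc]
    rfl
  have h' := congrArg F.map h
  rw [F.map_comp, F.map_comp] at h'
  exact congrArg (fun f => f.hom v) h'

/-- The natural transformation `τ_1 ⋙ LM ⟶ LM ⋙ τ_1`,
`i ⊗ v ↦ (ι_{F_1} * id)(i) ⊗ F(b_{1,1}⁻¹ ♮ id_n)(v)`. -/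
def translationLongMoody (hc : Coherent ς a) :
    translation K (.of 1) ⋙ longMoody K hc ⟶ longMoody K hc ⋙ translation K (.of 1) where
  app F :=
    { app := fun n => ModuleCat.ofHom (AugTensor.map (freeShift 1 le_rfl)
        (F.map (swap n)).hom (freeAction_swap K hc F n))
      naturality := by
        intro n n' p
        refine ModuleCat.hom_ext (AugTensor.hom_ext fun i v => ?_)
        have h := congrArg F.map (swap_naturality p)
        rw [F.map_comp, F.map_comp] at h
        refine congrArg₂ (AugTensor.tmul _) ?_ (congrArg (fun f => f.hom v) h.symm)
        refine (augMap_comp _ _ i).symm.trans (Eq.trans ?_ (augMap_comp _ _ i))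
        exact congrArg (fun φ => augMap φ i) (hc.freeHom_id_tensorHom_shift p).symm }
  naturality := by
    intro F G η
    ext n : 2
    refine ModuleCat.hom_ext (AugTensor.hom_ext fun i v => ?_)
    exact congrArg₂ (AugTensor.tmul _)
      ((congrArg _ (augMap_id i)).trans (augMap_id _).symm)
      (congrArg (fun f => f.hom v) (η.naturality (swap n))).symm

/-- The natural transformation `τ_2 ⟶ LM ⋙ τ_1`, `v ↦ (g_1 - 1) ⊗ v`. -/
def translationTwoLongMoody (hr : Reliable ς a) :
    translation K (.of 2) ⟶ longMoody K hr.toCoherent ⋙ translation K (.of 1) where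
  app F :=
    { app := fun n => ModuleCat.ofHom (AugTensor.mk (freeAction ς F (tensorObj (.of 1) n))
        (AugIdeal.diff (FreeGroup.of ⟨0, by change 0 < 1 + _; omega⟩)) ∘ₗ
          (F.map (assocTwo n).hom).hom)
      naturality := by
        intro n n' p
        have h := congrArg F.map (assocTwo_naturality p)
        rw [F.map_comp, F.map_comp] at h
        refine ModuleCat.hom_ext (LinearMap.ext fun v => ?_)
        refine Eq.trans ?_ (congrArg₂ (AugTensor.tmul _)
          ((augMap_diff _ _).trans (congrArg _ (hr.freeHom_id_tensorHom_of_zero p))).symm rfl)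
        exact congrArg (AugTensor.tmul _ _) (congrArg (fun f => f.hom v) h) }
  naturality := by
    intro F G η
    ext n : 2
    refine ModuleCat.hom_ext (LinearMap.ext fun v => ?_)
    refine Eq.trans ?_ (congrArg₂ (AugTensor.tmul _) (augMap_id _).symm rfl)
    exact congrArg (AugTensor.tmul _ _)
      (congrArg (fun f => f.hom v) (η.naturality (assocTwo n).hom)).symm

/-- The value of LM(F) on ι_1 ♮ id_n uses F(id_1 ♮ ι_1 ♮ id_n), while LM(i_1) uses F(ι_1 ♮
id_{1+n}). They differ by the exchange b_{1,1}⁻¹ ♮ id_n built into `translationLongMoody`. -/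
theorem translationUnit_longMoody (hc : Coherent ς a) :
    Functor.whiskerLeft (longMoody K hc) (translationUnit K (.of 1)) =
      Functor.whiskerRight (translationUnit K (.of 1)) (longMoody K hc) ≫
        translationLongMoody K hc := by
  ext F n : 4
  refine ModuleCat.hom_ext (AugTensor.hom_ext fun i v => ?_)
  have h := (congrArg F.map (id_tensorHom_unitTensor n)).trans (F.map_comp _ _)
  refine Eq.trans (b := AugTensor.tmul _ (augMap (hc.freeHom ((unitTensor (.of 1)).app n)) i)
    ((F.map (tensorHom (𝟙 (UBeta.of 1)) ((unitTensor (.of 1)).app n))).hom v)) rfl ?_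
  refine congrArg₂ (AugTensor.tmul _) ?_ (congrArg (fun f => f.hom v) h)
  rw [hc.freeHom_unitTensor]
  exact (congrArg _ (augMap_id i)).symm

theorem isIso_biprod_desc {R : Type*} [Ring R] {A B M : ModuleCat.{u} R} (f : A ⟶ M) (g : B ⟶ M)
    (h : Function.Bijective (f.hom.coprod g.hom)) : IsIso (biprod.desc f g) := by
  have e : (ModuleCat.biprodIsoProd A B).hom ≫ ModuleCat.ofHom (f.hom.coprod g.hom) =
      biprod.desc f g := by
    rw [← Iso.eq_inv_comp, biprod.desc_eq, Preadditive.comp_add, ← Category.assoc,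
      ← Category.assoc, ModuleCat.biprodIsoProd_inv_comp_fst,
      ModuleCat.biprodIsoProd_inv_comp_snd]
    refine ModuleCat.hom_ext (LinearMap.ext fun x => ?_)
    simp
  have : IsIso (ModuleCat.ofHom (f.hom.coprod g.hom)) :=
    (ConcreteCategory.isIso_iff_bijective _).2 h
  rw [← e]
  infer_instance

/-- Isomorphisms of functors are detected pointwise, and evaluation preserves biproducts. -/
theorem isIso_biprod_desc_of_app {C D : Type*} [Category* C] [Category* D] [Abelian D]
    {F G H : C ⥤ D} (f : F ⟶ H) (g : G ⟶ H) (h : ∀ X, IsIso (biprod.desc (f.app X) (g.app X))) :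
    IsIso (biprod.desc f g) := by
  rw [NatTrans.isIso_iff_isIso_app]
  intro X
  have := preservesBinaryBiproducts_of_preservesBiproducts ((evaluation C D).obj X)
  have := biprod.mapBiprod_hom_desc ((evaluation C D).obj X) F G f g
  have h' := h X
  refine (congrArg (fun f => IsIso f) this).mp ?_
  exact IsIso.comp_isIso' inferInstance h'

theorem isIso_splitting (hr : Reliable ς a) :
    IsIso (biprod.desc (translationTwoLongMoody K hr) (translationLongMoody K hr.toCoherent)) := by
  -- The pointwise criterion is used twice, first at the functor F and then at the object n, which
  -- leaves a statement about modules.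
  refine isIso_biprod_desc_of_app _ _ fun F => isIso_biprod_desc_of_app _ _ fun n =>
    isIso_biprod_desc _ _ ?_
  exact AugTensor.coprod_bijective (F.map (assocTwo n).hom).hom
    ((ConcreteCategory.isIso_iff_bijective _).1 inferInstance) (F.map (swap n)).hom
    ((ConcreteCategory.isIso_iff_bijective _).1 inferInstance)
    (freeAction_swap K hr.toCoherent F n)

/-- The isomorphism `τ_2 ⊕ (τ_1 ⋙ LM) ≅ LM ⋙ τ_1`. -/
def splittingIso (hr : Reliable ς a) :
    translation K (.of 2) ⊞ (translation K (.of 1) ⋙ longMoody K hr.toCoherent) ≅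
      longMoody K hr.toCoherent ⋙ translation K (.of 1) :=
  have := isIso_splitting K hr
  asIso (biprod.desc (translationTwoLongMoody K hr) (translationLongMoody K hr.toCoherent))

theorem whiskerRight_translationUnit_comp_inr (hr : Reliable ς a) :
    (Functor.whiskerRight (translationUnit K (.of 1)) (longMoody K hr.toCoherent) ≫
      (biprod.inr : _ ⟶ translation K (.of 2) ⊞ _)) ≫ (splittingIso K hr).hom =
    Functor.whiskerLeft (longMoody K hr.toCoherent) (translationUnit K (.of 1)) := by
  rw [translationUnit_longMoody, Category.assoc]
  congr 1
  exact biprod.inr_desc _ _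

/-- `LM ⋙ δ_1 ≅ τ_2 ⊕ (δ_1 ⋙ LM)`. -/
def longMoodyDifferenceIso (hr : Reliable ς a) :
    longMoody K hr.toCoherent ⋙ difference K (.of 1) ≅
      translation K (.of 2) ⊞ (difference K (.of 1) ⋙ longMoody K hr.toCoherent) :=
  let e₁ : longMoody K hr.toCoherent ⋙ cokernel (translationUnit K (.of 1)) ≅
      cokernel (Functor.whiskerLeft (longMoody K hr.toCoherent) (translationUnit K (.of 1))) :=
    whiskerLeftCokernel _ _
  let e₂ := cokernelIsoBiprod
    (Functor.whiskerLeft (longMoody K hr.toCoherent) (translationUnit K (.of 1)))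
    (Functor.whiskerRight (translationUnit K (.of 1)) (longMoody K hr.toCoherent))
    (splittingIso K hr) (whiskerRight_translationUnit_comp_inr K hr)
  let e₃ : cokernel (translationUnit K (.of 1)) ⋙ longMoody K hr.toCoherent ≅
      cokernel (Functor.whiskerRight (translationUnit K (.of 1)) (longMoody K hr.toCoherent)) :=
    whiskerRightCokernel _ _
  -- Only the last factor uses right exactness of LM; the first holds for precomposition with any
  -- functor.
  e₁ ≪≫ e₂ ≪≫ biprod.mapIso (Iso.refl _) e₃.symm

/-- `LM ⋙ κ_1 ≅ κ_1 ⋙ LM`. -/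
def longMoodyEvanescenceIso (hr : Reliable ς a) :
    longMoody K hr.toCoherent ⋙ evanescence K (.of 1) ≅
      evanescence K (.of 1) ⋙ longMoody K hr.toCoherent :=
  let e₁ : longMoody K hr.toCoherent ⋙ kernel (translationUnit K (.of 1)) ≅
      kernel (Functor.whiskerLeft (longMoody K hr.toCoherent) (translationUnit K (.of 1))) :=
    whiskerLeftKernel _ _
  let e₂ := kernelIsoOfBiprod
    (Functor.whiskerLeft (longMoody K hr.toCoherent) (translationUnit K (.of 1)))
    (Functor.whiskerRight (translationUnit K (.of 1)) (longMoody K hr.toCoherent))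
    (splittingIso K hr) (whiskerRight_translationUnit_comp_inr K hr)
  let e₃ : kernel (translationUnit K (.of 1)) ⋙ longMoody K hr.toCoherent ≅
      kernel (Functor.whiskerRight (translationUnit K (.of 1)) (longMoody K hr.toCoherent)) :=
    whiskerRightKernel _ _
  -- The summand τ_2 leaves no trace here, since the inclusion of the other summand is a
  -- monomorphism; the last factor uses left exactness of LM.
  e₁ ≪≫ e₂ ≪≫ e₃.symm

end Splitting

end

end LongMoody

open CategoryTheory CategoryTheory.Limits LongMoody
theorem mainTheorem3 {K : Type*} [CommRing K]
    (ς : ∀ n : ℕ, FreeGroup (Fin n) →* BraidGroup (1 + n))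
    (a : ∀ n : ℕ, BraidGroup n →* MulAut (FreeGroup (Fin n)))
    (h : Reliable ς a) :
    Nonempty (longMoody K h.toCoherent ⋙ difference K (.of 1) ≅
        translation K (.of 2) ⊞ (difference K (.of 1) ⋙ longMoody K h.toCoherent)) ∧
      Nonempty (longMoody K h.toCoherent ⋙ evanescence K (.of 1) ≅
        evanescence K (.of 1) ⋙ longMoody K h.toCoherent) :=
  ⟨⟨longMoodyDifferenceIso K h⟩, ⟨longMoodyEvanescenceIso K h⟩⟩
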